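/- **Setting.** Let a fractured porous medium in $\mathbb R^n$ be decomposed into finitely many connected subdomains $\Omega_i$ of dimensions $0\le d_i\le n$ (rock, fractures, intersections), and let an interface $\Gamma_e$ be one side of a lower-dimensional subdomain, lying along $\Omega_{i}$ of dimension $d$ and on the boundary of an adjacent subdomain of dimension $d+1$. The medium is connected through the interfaces, and the Dirichlet boundary has positive measure. Each $\Omega_i$ carries a conforming simplicial mesh and each $\Gamma_e$ its own simplicial mortar mesh; these meshes need not match, except that each $\Gamma_e$ is a union of facets of the mesh of the adjacent $(d+1)$-dimensional subdomain. Let $\mathbf V_h$ be the lowest-order Raviart–Thomas space on the subdomains with zero normal flux on the Neumann boundary (and no flux in points), $\mathbf V_{0h}\subset \mathbf V_h$ the subspace with zero normal flux on all interfaces, $\Lambda_h$ and $Q_h$ the piecewise constants on the mortar meshes and on the subdomain meshes, and $\mathbf W_h=\mathbf V_{0h}\times\Lambda_h$. Let $R_h:\Lambda_h\to\mathbf V_h$ be the extension whose normal component is, on interface facets, the $L^2$-projection of the mortar function onto the normal traces of $\mathbf V_h$, and $0$ on all other facets. The physical parameters are a symmetric positive definite tensor $K$, constant on each subdomain; a normal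 permeability $K_\nu$ bounded above and below by positive constants; and $\gamma>0$, constant on each interface. For $\mathbf w=[\mathbf u_0,\lambda]$, $\mathbf r=[\mathbf v_0,\mu]\in\mathbf W_h$ and $p\in Q_h$ put $$a(\mathbf w,\mathbf r)=(K^{-1}(\mathbf u_0+R_h\lambda),\mathbf v_0+R_h\mu)_\Omega+(\gamma K_\nu^{-1}\lambda,\mu)_\Gamma,\qquad b(\mathbf r,p)=-(p,\nabla\cdot(\mathbf v_0+R_h\mu)+[\![\mu]\!])_\Omega ,$$ where $[\![\mu]\!]$ on a subdomain is minus the sum of $\mu$ over the interfaces lying along it. Let $a^D$ be obtained from $a$ by replacing, on each cell $T$, the product $(K^{-1}\mathbf u,\mathbf v)_T$ by its diagonal part $\sum_{f\subset\partial T}(\mathbf u\cdot\nu_f)(\mathbf v\cdot\nu_f)(K^{-1}\phi_f,\phi_f)_T$, where $\phi_f$ is the Raviart–Thomas basis function of the facet $f$. Let $A,D_A:\mathbf W_h\to\mathbf W_h'$ and $B:\mathbf W_h\to Q_h'$ be the operators of $a$, $a^D$, $b$, and $$\mathcal A=\begin{pmatrix}A&B^T\\-B&0\end{pmatrix},\qquad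 \mathcal B_D=\begin{pmatrix}A&0\\0&BD_A^{-1}B^T\end{pmatrix}^{-1},\qquad \mathcal B_L=\begin{pmatrix}A&0\\-B&BD_A^{-1}B^T\end{pmatrix}^{-1},$$ $(\mathbf x,\mathbf y)_{\mathcal B_D^{-1}}=\langle\mathcal B_D^{-1}\mathbf x,\mathbf y\rangle$ and $\|\mathbf x\|_{\mathcal B_D^{-1}}^2=(\mathbf x,\mathbf x)_{\mathcal B_D^{-1}}$. **Theorem.** The operator $D_A$ and the two block operators inverted above are bijective, and $(\cdot,\cdot)_{\mathcal B_D^{-1}}$ is an inner product on $\mathbf W_h\times Q_h$. If $c_1,c_2>0$ satisfy $$c_1\,a^D(\mathbf r,\mathbf r)\le a(\mathbf r,\mathbf r)\le c_2\,a^D(\mathbf r,\mathbf r)\qquad\text{for all }\mathbf r\in\mathbf W_h,\tag{1}$$ then for every $\mathbf x\in\mathbf W_h\times Q_h$, $\mathbf x\ne 0$, $$\xi_1\le\frac{(\mathcal B_L\mathcal A\mathbf x,\mathbf x)_{\mathcal B_D^{-1}}}{(\mathbf x,\mathbf x)_{\mathcal B_D^{-1}}},\qquad \frac{\|\mathcal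 B_L\mathcal A\mathbf x\|_{\mathcal B_D^{-1}}}{\|\mathbf x\|_{\mathcal B_D^{-1}}}\le\xi_2,\qquad \xi_1=\tfrac12\min\{1,c_2^{-1}\},\quad \xi_2=\max\{2,2c_1^{-1}\}.\tag{2}$$ Moreover, for all $n,\sigma,\kappa$ there are constants $c_1,c_2>0$, depending only on $n,\sigma,\kappa$, such that (1), and hence (2), holds for every such medium, all meshes with shape-regularity constant at most $\sigma$ (each cell $T$ of a subdomain mesh contains a $d_i$-dimensional ball of radius $r$ with $\operatorname{diam}T\le\sigma r$) and all parameters $K,K_\nu,\gamma$ such that on each subdomain the ratio of the largest to the smallest eigenvalue of $K$ is at most $\kappa$. In particular, for isotropic $K$ ($\kappa=1$), $\xi_1$ and $\xi_2$ depend only on $n$ and on the shape regularity of the meshes, so $\mathcal B_L$ is field-of-values equivalent to $\mathcal A$, uniformly in the mesh size and in the physical parameters. -/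

import Mathlib

open MeasureTheory

noncomputable section

namespace MixedDim

/-- The ambient Euclidean space. -/
abbrev E (n : ℕ) : Type := EuclideanSpace ℝ (Fin n)

/-- Role of a facet of a cell of a subdomain mesh. `F` is the type of all facets of that mesh and
`J` the type of interfaces. -/
inductive FacetKind (F J : Type) : Type
  /-- interior facet, identified with a facet of another cell of the same mesh -/
  | glued (G : F)
  /-- facet on the part of the outer boundary where the pressure is prescribed -/
  | dirichlet
  /-- facet on which the normal flux vanishes -/
  | neumann
  /-- facet lying on the interface `e` with a subdomain of one dimension less -/
  | mortar (e : J)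

/-- A fractured porous medium in `ℝⁿ` with its simplicial meshes.

The subdomains `i : Sub` have dimension `dim i` (the rock has dimension `n`, the fractures have
dimension `n - 1`, their intersections lower dimensions). Each one is the union of the simplices of
its own mesh. The cell `T` of subdomain `i` is the convex hull of the `dim i + 1` points
`vert i T k`, and its facet `(T, k)` is the one opposite to the vertex `k`. An interface `e : Ifc`
is one side of the lower dimensional subdomain `lower e`, seen from the subdomain `upper e` of one
dimension more; it has its own mortar mesh. The meshes of `upper e`, of `lower e` and the
mortar mesh need not match. Both sides of a fracture may belong to the same subdomain: they are then
two different interfaces, and the facets on the two sides are not glued. -/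
structure Mesh (n : ℕ) where
  /-- the subdomains, of all dimensions -/
  Sub : Type
  [fintypeSub : Fintype Sub]
  dim : Sub → ℕ
  /-- the cells of the mesh of a subdomain -/
  Cell : Sub → Type
  [fintypeCell : ∀ i, Fintype (Cell i)]
  [nonemptyCell : ∀ i, Nonempty (Cell i)]
  vert : ∀ i, Cell i → Fin (dim i + 1) → E n
  vert_indep : ∀ i T, AffineIndependent ℝ (vert i T)
  /-- different cells overlap in a null set only -/
  cell_nonoverlap : ∀ i T T', T ≠ T' →
    μHE[dim i] (convexHull ℝ (Set.range (vert i T)) ∩ convexHull ℝ (Set.range (vert i T'))) = 0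
  /-- the interfaces, of all dimensions -/
  Ifc : Type
  [fintypeIfc : Fintype Ifc]
  lower : Ifc → Sub
  upper : Ifc → Sub
  dim_upper : ∀ e, dim (upper e) = dim (lower e) + 1
  /-- the cells of the mortar mesh of an interface -/
  MCell : Ifc → Type
  [fintypeMCell : ∀ e, Fintype (MCell e)]
  [nonemptyMCell : ∀ e, Nonempty (MCell e)]
  mvert : ∀ e, MCell e → Fin (dim (lower e) + 1) → E n
  mvert_indep : ∀ e m, AffineIndependent ℝ (mvert e m)
  mcell_nonoverlap : ∀ e m m', m ≠ m' →
    μHE[dim (lower e)]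
      (convexHull ℝ (Set.range (mvert e m)) ∩ convexHull ℝ (Set.range (mvert e m'))) = 0
  /-- the role of each facet -/
  kind : ∀ i, Cell i × Fin (dim i + 1) → FacetKind (Cell i × Fin (dim i + 1)) Ifc
  /-- gluing is symmetric, ... -/
  glued_symm : ∀ i F G, kind i F = .glued G → kind i G = .glued F
  /-- ... joins facets of different cells ... -/
  glued_ne : ∀ i F G, kind i F = .glued G → F.1 ≠ G.1
  /-- ... and only facets with the same vertices: the mesh is conforming -/
  glued_vert : ∀ i F G, kind i F = .glued G →
    vert i F.1 '' {F.2}ᶜ = vert i G.1 '' {G.2}ᶜ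
  /-- there is no flow within a point -/
  kind_point : ∀ i F, dim i = 0 → kind i F = .neumann
  kind_mortar : ∀ i F e, kind i F = .mortar e → upper e = i
  /-- an interface is the union of the facets of the mesh of `upper e` that lie on it ... -/
  mortar_cover : ∀ e,
    (⋃ F ∈ {F | kind (upper e) F = .mortar e},
      convexHull ℝ (vert (upper e) F.1 '' {F.2}ᶜ)) =
    ⋃ m, convexHull ℝ (Set.range (mvert e m))
  /-- ... which do not overlap, ... -/
  mortar_nonoverlap : ∀ e F G, kind (upper e) F = .mortar e → kind (upper e) G = .mortar e →
    F ≠ G → μHE[dim (lower e)]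
      (convexHull ℝ (vert (upper e) F.1 '' {F.2}ᶜ) ∩
        convexHull ℝ (vert (upper e) G.1 '' {G.2}ᶜ)) = 0
  /-- ... and it lies along the subdomain `lower e` -/
  mortar_subset : ∀ e,
    (⋃ m, convexHull ℝ (Set.range (mvert e m))) ⊆
      ⋃ T, convexHull ℝ (Set.range (vert (lower e) T))
  /-- each subdomain is connected (through facets of its mesh) -/
  sub_connected : ∀ i T T',
    Relation.ReflTransGen (fun S S' => ∃ k k', kind i (S, k) = .glued (S', k')) T T'
  /-- the whole medium is connected (through interfaces) -/
  connected : ∀ i j, Relation.EqvGen (fun i j => ∃ e, upper e = i ∧ lower e = j) i j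
  /-- the Dirichlet boundary has positive measure -/
  exists_dirichlet : ∃ i F, kind i F = .dirichlet

attribute [instance] Mesh.fintypeSub Mesh.fintypeCell Mesh.nonemptyCell Mesh.fintypeIfc
  Mesh.fintypeMCell Mesh.nonemptyMCell

namespace Mesh

variable {n : ℕ} (G : Mesh n)

/-- The cell as a subset of `ℝⁿ`. -/
def cellSet (i : G.Sub) (T : G.Cell i) : Set (E n) := convexHull ℝ (Set.range (G.vert i T))

/-- The facet of `T` opposite to its vertex `k`. -/
def facetSet (i : G.Sub) (T : G.Cell i) (k : Fin (G.dim i + 1)) : Set (E n) :=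
  convexHull ℝ (G.vert i T '' {k}ᶜ)

/-- The mortar cell as a subset of `ℝⁿ`. -/
def mcellSet (e : G.Ifc) (m : G.MCell e) : Set (E n) := convexHull ℝ (Set.range (G.mvert e m))

/-- Volume of a cell; `μHE[d]` is the `d`-dimensional Lebesgue (surface) measure in `ℝⁿ`. -/
def cellVol (i : G.Sub) (T : G.Cell i) : ℝ := (μHE[G.dim i] : Measure (E n)).real (G.cellSet i T)

/-- Area of a facet. -/
def facetVol (i : G.Sub) (T : G.Cell i) (k : Fin (G.dim i + 1)) : ℝ :=
  (μHE[G.dim i - 1] : Measure (E n)).real (G.facetSet i T k)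

/-- Every cell `T` contains a ball of its own dimension whose radius `r` satisfies
`diam T ≤ σ r`. -/
def ShapeRegular (σ : ℝ) : Prop :=
  ∀ i T, ∃ c ∈ affineSpan ℝ (Set.range (G.vert i T)), ∃ r > 0,
    Metric.closedBall c r ∩ (affineSpan ℝ (Set.range (G.vert i T)) : Set (E n)) ⊆ G.cellSet i T ∧
    Metric.diam (G.cellSet i T) ≤ σ * r

/-! ### Lowest order Raviart-Thomas functions -/

/-- The coefficient `|f| / (d |T|)` of the Raviart-Thomas basis function of a facet. -/
def rtCoef (i : G.Sub) (T : G.Cell i) (k : Fin (G.dim i + 1)) : ℝ :=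
  G.facetVol i T k / (G.dim i * G.cellVol i T)

/-- The Raviart-Thomas basis function on `T` of the facet `f` opposite to the vertex `x_k`,
`φ(x) = |f| / (d |T|) (x - x_k)`. Its outer normal component is `1` on `f` and `0` on the other
facets of `T`. -/
def rtBasis (i : G.Sub) (T : G.Cell i) (k : Fin (G.dim i + 1)) (x : E n) : E n :=
  G.rtCoef i T k • (x - G.vert i T k)

/-- Elementwise Raviart-Thomas functions on all subdomains, represented by their outer normal
components on the facets: `u` stands for the field `∑ k, u i T k • rtBasis i T k` on each `T`. -/
abbrev Flux : Type := ∀ i, G.Cell i → Fin (G.dim i + 1) → ℝ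

/-- The (constant) divergence on the cell `T` of a Raviart-Thomas function; the divergence of
`x ↦ c (x - x_k)` on a `d`-dimensional cell is `d c`. -/
def divCell (u : G.Flux) (i : G.Sub) (T : G.Cell i) : ℝ :=
  ∑ k, u i T k * (G.dim i * G.rtCoef i T k)

/-- The space `V_h`: the normal component is continuous across interior facets (the outer normals of
the two cells are opposite) and zero on Neumann facets. -/
def Vh : Submodule ℝ G.Flux where
  carrier := {u | (∀ i F F', G.kind i F = .glued F' → u i F.1 F.2 = - u i F'.1 F'.2) ∧
    ∀ i F, G.kind i F = .neumann → u i F.1 F.2 = 0}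
  add_mem' := by
    rintro u v ⟨hu, hu'⟩ ⟨hv, hv'⟩
    refine ⟨fun i F F' h => ?_, fun i F h => ?_⟩
    · simp only [Pi.add_apply, hu i F F' h, hv i F F' h]; ring
    · simp [hu' i F h, hv' i F h]
  zero_mem' := by simp
  smul_mem' := by
    rintro c u ⟨hu, hu'⟩
    refine ⟨fun i F F' h => ?_, fun i F h => ?_⟩
    · simp [hu i F F' h]
    · simp [hu' i F h]

/-- The space `V_{0h}`: in addition the normal component is zero on all interfaces. -/
def V0h : Submodule ℝ G.Flux where
  carrier := {u | u ∈ G.Vh ∧ ∀ i F e, G.kind i F = .mortar e → u i F.1 F.2 = 0}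
  add_mem' := by
    rintro u v ⟨hu, hu'⟩ ⟨hv, hv'⟩
    exact ⟨G.Vh.add_mem hu hv, fun i F e h => by simp [hu' i F e h, hv' i F e h]⟩
  zero_mem' := ⟨G.Vh.zero_mem, by simp⟩
  smul_mem' := by
    rintro c u ⟨hu, hu'⟩
    exact ⟨G.Vh.smul_mem c hu, fun i F e h => by simp [hu' i F e h]⟩

/-- The mortar space `Λ_h` of piecewise constants on the mortar meshes. -/
abbrev Lam : Type := ∀ e, G.MCell e → ℝ

/-- The pressure space `Q_h` of piecewise constants on the meshes of the subdomains. -/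
abbrev Qh : Type := ∀ i, G.Cell i → ℝ

/-- The space `W_h = V_{0h} × Λ_h` of all fluxes. -/
abbrev Wh : Type := G.V0h × G.Lam

/-- The value on the facet `(T, k)` of the `L²` projection of the mortar function `μ` on the
interface `e` onto the normal traces of `V_h`, that is, onto the functions that are constant on each
facet: the mean of `μ` over the facet. -/
def mortarProj (μ : G.Lam) (e : G.Ifc) (i : G.Sub) (T : G.Cell i) (k : Fin (G.dim i + 1)) : ℝ :=
  (∑ m, μ e m * (μHE[G.dim (G.lower e)] : Measure (E n)).real
    (G.facetSet i T k ∩ G.mcellSet e m)) / G.facetVol i T k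

/-- The discrete extension operator `R_h : Λ_h → V_h`: the normal component of `R_h μ` is the
projection of `μ` on the facets on an interface, and zero on all other facets. -/
def Rh : G.Lam →ₗ[ℝ] G.Vh where
  toFun μ := ⟨fun i T k => match G.kind i (T, k) with
      | .mortar e => G.mortarProj μ e i T k
      | _ => 0, by
    refine ⟨fun i F F' h => ?_, fun i F h => ?_⟩
    · have h' := G.glued_symm i F F' h
      simp [h, h']
    · simp [h]⟩
  map_add' μ μ' := by
    ext i T k
    simp only [Submodule.coe_add, Pi.add_apply]
    cases G.kind i (T, k) <;> simp [mortarProj, add_mul, Finset.sum_add_distrib, add_div]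
  map_smul' c μ := by
    ext i T k
    simp only [Submodule.coe_smul, Pi.smul_apply, RingHom.id_apply]
    cases G.kind i (T, k) <;>
      simp [mortarProj, mul_assoc, ← Finset.mul_sum, mul_div_assoc]

/-- The total flux `v₀ + R_h μ` of `[v₀, μ] ∈ W_h`. -/
def total : G.Wh →ₗ[ℝ] G.Flux :=
  G.V0h.subtype ∘ₗ LinearMap.fst ℝ G.V0h G.Lam +
    (G.Vh.subtype ∘ₗ G.Rh) ∘ₗ LinearMap.snd ℝ G.V0h G.Lam

/-- The pairing `(p, D · [v₀ + R_h μ, μ])_Ω = (p, ∇ · (v₀ + R_h μ))_Ω + (p, ⟦μ⟧)_Ω`, where the jump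
`⟦μ⟧` on a subdomain is minus the sum of `μ` over the interfaces `e` with that subdomain as
`lower e`. -/
def divPairing (r : G.Wh) (p : G.Qh) : ℝ :=
  (∑ i, ∑ T, p i T * (G.divCell (G.total r) i T * G.cellVol i T)) +
    ∑ e, ∑ T, ∑ m, p (G.lower e) T * (-(r.2 e m) *
      (μHE[G.dim (G.lower e)] : Measure (E n)).real (G.cellSet (G.lower e) T ∩ G.mcellSet e m))

/-- The operator `B : W_h → Q_h'`, `⟨B r, p⟩ = b(r, p) = -(p, D · [v₀ + R_h μ, μ])_Ω`. -/
def opB : G.Wh →ₗ[ℝ] Module.Dual ℝ G.Qh :=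
  LinearMap.mk₂ ℝ (fun r p => - G.divPairing r p)
    (by
      intro r r' p
      simp only [divPairing, divCell, map_add, Pi.add_apply, Prod.snd_add, add_mul, neg_add,
        mul_add, Finset.sum_add_distrib]
      ring)
    (by
      intro c r p
      simp only [divPairing, divCell, map_smul, Pi.smul_apply, Prod.smul_snd, smul_eq_mul,
        Finset.mul_sum, Finset.sum_mul, mul_neg, mul_add]
      congr 2 <;> (repeat' (refine Finset.sum_congr rfl fun _ _ => ?_)) <;> ring)
    (by
      intro r p p'
      simp only [divPairing, Pi.add_apply, add_mul, neg_add, Finset.sum_add_distrib]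
      ring)
    (by
      intro c r p
      simp only [divPairing, Pi.smul_apply, smul_eq_mul, Finset.mul_sum, mul_neg, mul_add]
      congr 2 <;> (repeat' (refine Finset.sum_congr rfl fun _ _ => ?_)) <;> ring)

/-- The transposed operator `Bᵀ : Q_h → W_h'`. -/
def opBT : G.Qh →ₗ[ℝ] Module.Dual ℝ G.Wh := G.opB.flip

end Mesh

/-- The physical parameters: a symmetric positive definite permeability tensor `K i`, constant on
each subdomain (only its inverse on tangent vectors enters); a normal permeability `Kν e`, bounded
above and below by positive constants; a positive constant aperture `γ e` on each interface. -/
structure Params {n : ℕ} (G : Mesh n) where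
  K : G.Sub → Matrix (Fin n) (Fin n) ℝ
  K_posDef : ∀ i, (K i).PosDef
  Kν : G.Ifc → E n → ℝ
  Kν_measurable : ∀ e, Measurable (Kν e)
  Kν_bounds : ∀ e, ∃ a b : ℝ, 0 < a ∧ ∀ x, a ≤ Kν e x ∧ Kν e x ≤ b
  γ : G.Ifc → ℝ
  γ_pos : ∀ e, 0 < γ e

/-- The inverse of a bijective linear map (and `0` if the map is not bijective). -/
def invOp {X Y : Type*} [AddCommGroup X] [Module ℝ X] [AddCommGroup Y] [Module ℝ Y]
    (f : X →ₗ[ℝ] Y) : Y →ₗ[ℝ] X :=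
  open Classical in
  if h : Function.Bijective f then ((LinearEquiv.ofBijective f h).symm : Y →ₗ[ℝ] X) else 0

namespace Params

variable {n : ℕ} {G : Mesh n} (P : Params G)

/-- On each subdomain the ratio of the largest to the smallest eigenvalue of `K` is at most `κ`. For
isotropic permeabilities this holds with `κ = 1`. -/
def AnisotropyLE (κ : ℝ) : Prop :=
  ∀ i (ξ η : E n), inner ℝ ξ (Matrix.toEuclideanLin (P.K i) ξ) * ‖η‖ ^ 2 ≤
    κ * (inner ℝ η (Matrix.toEuclideanLin (P.K i) η) * ‖ξ‖ ^ 2)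

/-- The local matrix entry `(K⁻¹ φ_k, φ_l)_T`. -/
def mass (i : G.Sub) (T : G.Cell i) (k l : Fin (G.dim i + 1)) : ℝ :=
  ∫ x in G.cellSet i T,
    inner ℝ (Matrix.toEuclideanLin (P.K i)⁻¹ (G.rtBasis i T k x)) (G.rtBasis i T l x) ∂μHE[G.dim i]

/-- The form `(K⁻¹ u, v)_Ω` on Raviart-Thomas functions. -/
def fluxForm : G.Flux →ₗ[ℝ] G.Flux →ₗ[ℝ] ℝ :=
  LinearMap.mk₂ ℝ (fun u v => ∑ i, ∑ T, ∑ k, ∑ l, u i T k * v i T l * P.mass i T k l)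
    (by intro u u' v; simp [add_mul, Finset.sum_add_distrib])
    (by intro c u v; simp [Finset.mul_sum, mul_assoc])
    (by intro u v v'; simp [add_mul, mul_add, Finset.sum_add_distrib])
    (by intro c u v; simp [Finset.mul_sum, mul_assoc, mul_left_comm])

/-- The form `(K⁻¹ u, v)_{D,Ω}`: only the diagonal entries of the local matrices are kept. -/
def fluxFormD : G.Flux →ₗ[ℝ] G.Flux →ₗ[ℝ] ℝ :=
  LinearMap.mk₂ ℝ (fun u v => ∑ i, ∑ T, ∑ k, u i T k * v i T k * P.mass i T k k)
    (by intro u u' v; simp [add_mul, Finset.sum_add_distrib])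
    (by intro c u v; simp [Finset.mul_sum, mul_assoc])
    (by intro u v v'; simp [add_mul, mul_add, Finset.sum_add_distrib])
    (by intro c u v; simp [Finset.mul_sum, mul_assoc, mul_left_comm])

/-- The form `(γ Kν⁻¹ λ, μ)_Γ` on mortar functions. -/
def mortarForm : G.Lam →ₗ[ℝ] G.Lam →ₗ[ℝ] ℝ :=
  LinearMap.mk₂ ℝ (fun lam μ => ∑ e, ∑ m, lam e m * μ e m *
      ∫ x in G.mcellSet e m, P.γ e * (P.Kν e x)⁻¹ ∂μHE[G.dim (G.lower e)])
    (by intro u u' v; simp [add_mul, Finset.sum_add_distrib])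
    (by intro c u v; simp [Finset.mul_sum, mul_assoc])
    (by intro u v v'; simp [add_mul, mul_add, Finset.sum_add_distrib])
    (by intro c u v; simp [Finset.mul_sum, mul_assoc, mul_left_comm])

/-- The operator `A : W_h → W_h'`,
`⟨A w, r⟩ = a(w, r) = (K⁻¹ (u₀ + R_h λ), v₀ + R_h μ)_Ω + (γ Kν⁻¹ λ, μ)_Γ`. -/
def opA : G.Wh →ₗ[ℝ] Module.Dual ℝ G.Wh :=
  P.fluxForm.compl₁₂ G.total G.total +
    P.mortarForm.compl₁₂ (LinearMap.snd ℝ G.V0h G.Lam) (LinearMap.snd ℝ G.V0h G.Lam)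

/-- The operator `D_A : W_h → W_h'`,
`⟨D_A w, r⟩ = a^D(w, r) = (K⁻¹ (u₀ + R_h λ), v₀ + R_h μ)_{D,Ω} + (γ Kν⁻¹ λ, μ)_Γ`. -/
def opDA : G.Wh →ₗ[ℝ] Module.Dual ℝ G.Wh :=
  P.fluxFormD.compl₁₂ G.total G.total +
    P.mortarForm.compl₁₂ (LinearMap.snd ℝ G.V0h G.Lam) (LinearMap.snd ℝ G.V0h G.Lam)

/-- `B D_A⁻¹ Bᵀ : Q_h → Q_h'`. -/
def schur : G.Qh →ₗ[ℝ] Module.Dual ℝ G.Qh := G.opB ∘ₗ invOp P.opDA ∘ₗ G.opBT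

/-- The block operator `𝒜 = [[A, Bᵀ], [-B, 0]]` from `X = W_h × Q_h` to `X' = W_h' × Q_h'`. -/
def opCalA : G.Wh × G.Qh →ₗ[ℝ] Module.Dual ℝ G.Wh × Module.Dual ℝ G.Qh :=
  (P.opA ∘ₗ LinearMap.fst ℝ G.Wh G.Qh + G.opBT ∘ₗ LinearMap.snd ℝ G.Wh G.Qh).prod
    (-(G.opB ∘ₗ LinearMap.fst ℝ G.Wh G.Qh))

/-- The block operator `[[A, 0], [0, B D_A⁻¹ Bᵀ]]`, the inverse of the preconditioner `ℬ_D`. -/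
def blockD : G.Wh × G.Qh →ₗ[ℝ] Module.Dual ℝ G.Wh × Module.Dual ℝ G.Qh :=
  (P.opA ∘ₗ LinearMap.fst ℝ G.Wh G.Qh).prod (P.schur ∘ₗ LinearMap.snd ℝ G.Wh G.Qh)

/-- The block operator `[[A, 0], [-B, B D_A⁻¹ Bᵀ]]`. -/
def blockL : G.Wh × G.Qh →ₗ[ℝ] Module.Dual ℝ G.Wh × Module.Dual ℝ G.Qh :=
  (P.opA ∘ₗ LinearMap.fst ℝ G.Wh G.Qh).prod
    (-(G.opB ∘ₗ LinearMap.fst ℝ G.Wh G.Qh) + P.schur ∘ₗ LinearMap.snd ℝ G.Wh G.Qh)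

/-- The exact block lower triangular preconditioner `ℬ_L = [[A, 0], [-B, B D_A⁻¹ Bᵀ]]⁻¹`. -/
def precondL : Module.Dual ℝ G.Wh × Module.Dual ℝ G.Qh →ₗ[ℝ] G.Wh × G.Qh := invOp P.blockL

/-- `(x, y)_{ℬ_D⁻¹} = ⟨ℬ_D⁻¹ x, y⟩`. -/
def innerBD (x y : G.Wh × G.Qh) : ℝ := (P.blockD x).1 y.1 + (P.blockD x).2 y.2

/-- `‖x‖_{ℬ_D⁻¹}`. -/
def normBD (x : G.Wh × G.Qh) : ℝ := Real.sqrt (P.innerBD x x)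

/-- The inverses of `D_A` and of the two block operators exist, and `(·, ·)_{ℬ_D⁻¹}` is an inner
product. -/
def WellDefined : Prop :=
  Function.Bijective P.opDA ∧ Function.Bijective P.blockD ∧ Function.Bijective P.blockL ∧
    (∀ x y, P.innerBD x y = P.innerBD y x) ∧ ∀ x, x ≠ 0 → 0 < P.innerBD x x

/-- The forms `a` and `a^D` are spectrally equivalent with constants `c₁` and `c₂`:
`c₁ ‖r‖²_{a^D} ≤ ‖r‖²_a ≤ c₂ ‖r‖²_{a^D}`. -/
def SpectrallyEquivalent (c₁ c₂ : ℝ) : Prop :=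
  ∀ r, c₁ * P.opDA r r ≤ P.opA r r ∧ P.opA r r ≤ c₂ * P.opDA r r

/-- The two field-of-values bounds for `ℬ_L 𝒜` in the `ℬ_D⁻¹` inner product. -/
def FOVBounds (ξ₁ ξ₂ : ℝ) : Prop :=
  ∀ x : G.Wh × G.Qh, x ≠ 0 →
    ξ₁ ≤ P.innerBD (P.precondL (P.opCalA x)) x / P.innerBD x x ∧
    P.normBD (P.precondL (P.opCalA x)) / P.normBD x ≤ ξ₂

end Params

end MixedDim

end

/-
On a cell `T` the upper bound in `c₁ aᴰ ≤ a ≤ c₂ aᴰ` is the Cauchy-Schwarz inequality over the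
facets of `T`. For the lower bound, let `u = ∑ k, a k (x - x_k)` on `T`, and let `l` be the linear
part of the barycentric coordinate of `x_k`, which changes by at most `1` over the inscribed ball
of radius `r`. At a vertex other than `x_k`, `l u = -a k`, so `r |a k| ≤ |u|` there. An affine
field is bounded at a vertex by its mean square over `T` with a constant that depends on the
dimension only, as contracting `T` towards the vertex shows. Hence `r² |a k|² |T| ≤ C (u, u)_T`,
while the `k`-th summand of `u` is at most `|a k| diam T ≤ σ r |a k|`. The tensor enters through
the ratio of its eigenvalues.

With `S = B A⁻¹ Bᵀ` and `S_D = B D_A⁻¹ Bᵀ` one finds `ℬ_L 𝒜 (w, p) = (w + A⁻¹ Bᵀ p, S_D⁻¹ S p)`,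
and the equivalence of `a` and `aᴰ` passes to `S` and `S_D`, so that both bounds become
inequalities between squares. These operators are positive definite because `Bᵀ` is injective:
testing `Bᵀ p = 0` with the jumps of `p` over the interior and Dirichlet facets, and then with its
jumps over the interfaces, makes `p` constant on the connected medium and zero on the Dirichlet
boundary.
-/

namespace MixedDim

section LinearAlgebra

variable {X Y : Type*} [AddCommGroup X] [Module ℝ X] [AddCommGroup Y] [Module ℝ Y]

/-- The map `A : X → X'` is the Riesz operator `x ↦ (x, ·)` of an inner product on `X`. -/
structure SymmPosDef (A : X →ₗ[ℝ] Module.Dual ℝ X) : Prop where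
  symm : ∀ x y, A x y = A y x
  pos : ∀ x, x ≠ 0 → 0 < A x x

lemma apply_invOp {f : X →ₗ[ℝ] Y} (hf : Function.Bijective f) (y : Y) : f (invOp f y) = y := by
  rw [invOp, dif_pos hf]
  exact (LinearEquiv.ofBijective f hf).apply_symm_apply y

lemma apply_add_self_le {β : LinearMap.BilinForm ℝ X} (hβ : ∀ x, 0 ≤ β x x) (x y : X) :
    β (x + y) (x + y) ≤ 2 * β x x + 2 * β y y := by
  have h := hβ (x - y)
  simp only [map_sub, map_add, LinearMap.sub_apply, LinearMap.add_apply] at h ⊢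
  linarith

lemma apply_sum_self_le_card_mul {ι : Type*} [Fintype ι] {β : LinearMap.BilinForm ℝ X}
    (hβ : ∀ x, 0 ≤ β x x) (y : ι → X) :
    β (∑ k, y k) (∑ k, y k) ≤ Fintype.card ι * ∑ k, β (y k) (y k) := by
  have hdiff : ∑ k, ∑ l, β (y k - y l) (y k - y l) =
      2 * (Fintype.card ι * ∑ k, β (y k) (y k)) - 2 * β (∑ k, y k) (∑ k, y k) := by
    simp only [map_sub, LinearMap.sub_apply, map_sum, LinearMap.sum_apply,
      Finset.sum_sub_distrib, Finset.sum_const, Finset.card_univ, nsmul_eq_mul, ← Finset.mul_sum]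
    rw [Finset.sum_comm (f := fun k l => β (y l) (y k))]
    ring
  have hnonneg : 0 ≤ ∑ k, ∑ l, β (y k - y l) (y k - y l) :=
    Finset.sum_nonneg fun _ _ => Finset.sum_nonneg fun _ _ => hβ _
  linarith

lemma sum_sum_mul_le_card_mul_sum_diag {ι : Type*} [Fintype ι] {M : ι → ι → ℝ}
    (hM : ∀ u : ι → ℝ, 0 ≤ ∑ k, ∑ l, u k * u l * M k l) (u : ι → ℝ) :
    ∑ k, ∑ l, u k * u l * M k l ≤ Fintype.card ι * ∑ k, u k * u k * M k k := by
  classical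
  have hform (x y : ι → ℝ) : Matrix.toBilin' (Matrix.of M) x y = ∑ k, ∑ l, x k * y l * M k l := by
    simp only [Matrix.toBilin'_apply, Matrix.of_apply, mul_right_comm]
  have h := apply_sum_self_le_card_mul (β := Matrix.toBilin' (Matrix.of M))
    (fun x => (hM x).trans_eq (hform x x).symm) fun k => Pi.single k (u k)
  rw [Finset.univ_sum_single] at h
  simpa [hform, Pi.single_apply] using h

namespace SymmPosDef

variable {A D : X →ₗ[ℝ] Module.Dual ℝ X}

lemma nonneg (hA : SymmPosDef A) (x : X) : 0 ≤ A x x := by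
  by_cases h : x = 0
  · simp [h]
  · exact (hA.pos x h).le

lemma sq_le (hA : SymmPosDef A) (x y : X) : A x y ^ 2 ≤ A x x * A y y :=
  LinearMap.BilinForm.apply_sq_le_of_symm A hA.nonneg ⟨hA.symm⟩ x y

lemma bijective [FiniteDimensional ℝ X] (hA : SymmPosDef A) : Function.Bijective A := by
  have hinj : Function.Injective A := by
    refine (injective_iff_map_eq_zero A).2 fun x hx => ?_
    by_contra h
    exact (hA.pos x h).ne' (by rw [hx, LinearMap.zero_apply])
  exact ⟨hinj, (LinearMap.injective_iff_surjective_of_finrank_eq_finrank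
    Subspace.dual_finrank_eq.symm).1 hinj⟩

/-- If `a D ≤ b A` as quadratic forms, then `a A⁻¹ ≤ b D⁻¹`. -/
lemma mul_apply_inv_le (hA : SymmPosDef A) (hD : SymmPosDef D) {a b : ℝ} (ha : 0 ≤ a)
    (h : ∀ x, a * D x x ≤ b * A x x) {f : Module.Dual ℝ X} {w z : X} (hw : A w = f)
    (hz : D z = f) : a * f w ≤ b * f z := by
  obtain rfl | hw₀ := eq_or_ne w 0
  · have hf : f = 0 := by rw [← hw, map_zero]
    simp [hf]
  have hpos : 0 < f w := hw ▸ hA.pos w hw₀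
  have hcs : f w ^ 2 ≤ f z * D w w := by rw [← hz]; exact hD.sq_le z w
  have hle : a * D w w ≤ b * f w := by rw [← hw]; exact h w
  have hfz : 0 ≤ f z := hz ▸ hD.nonneg z
  refine le_of_mul_le_mul_right ?_ hpos
  calc a * f w * f w = a * f w ^ 2 := by ring
    _ ≤ a * (f z * D w w) := mul_le_mul_of_nonneg_left hcs ha
    _ = f z * (a * D w w) := by ring
    _ ≤ f z * (b * f w) := mul_le_mul_of_nonneg_left hle hfz
    _ = b * f z * f w := by ring

end SymmPosDef

/-- The Schur complement `B A⁻¹ Bᵀ` of the block operator `[[A, Bᵀ], [-B, 0]]`. -/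
noncomputable def schurComplement (A : X →ₗ[ℝ] Module.Dual ℝ X) (B : X →ₗ[ℝ] Module.Dual ℝ Y) :
    Y →ₗ[ℝ] Module.Dual ℝ Y :=
  B ∘ₗ invOp A ∘ₗ B.flip

variable {A : X →ₗ[ℝ] Module.Dual ℝ X} {B : X →ₗ[ℝ] Module.Dual ℝ Y}

lemma schurComplement_apply (hA : Function.Bijective A) (p q : Y) :
    schurComplement A B p q = A (invOp A (B.flip q)) (invOp A (B.flip p)) := by
  rw [apply_invOp hA]
  rfl

lemma SymmPosDef.schurComplement [FiniteDimensional ℝ X] (hA : SymmPosDef A)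
    (hB : Function.Injective B.flip) : SymmPosDef (schurComplement A B) where
  symm p q := by
    rw [schurComplement_apply hA.bijective, schurComplement_apply hA.bijective, hA.symm]
  pos p hp := by
    rw [schurComplement_apply hA.bijective]
    refine hA.pos _ fun h => hp ((injective_iff_map_eq_zero _).1 hB p ?_)
    rw [← apply_invOp hA.bijective (B.flip p), h, map_zero]

section FieldOfValues

variable {S T : Y →ₗ[ℝ] Module.Dual ℝ Y} {p q : Y}

lemma SymmPosDef.apply_self_le_of_apply_eq (hS : SymmPosDef S) (hT : SymmPosDef T) {c : ℝ}
    (hTS : ∀ p, T p p ≤ c * S p p) (hq : S q = T p) : S q q ≤ c ^ 2 * S p p := by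
  obtain rfl | hq₀ := eq_or_ne q 0
  · simpa using mul_nonneg (sq_nonneg c) (hS.nonneg p)
  refine le_of_mul_le_mul_right ?_ (hS.pos q hq₀)
  calc S q q * S q q = T p q ^ 2 := by rw [hq, sq]
    _ ≤ T p p * T q q := hT.sq_le p q
    _ ≤ c * S p p * (c * S q q) :=
      mul_le_mul (hTS p) (hTS q) (hT.nonneg q) ((hT.nonneg p).trans (hTS p))
    _ = c ^ 2 * S p p * S q q := by ring

/-! In the next two lemmas `(w + a, q)` is the image of `(w, p)` under the operator `B_L 𝒜`: there
`A a = Bᵀ p`, and `T` is the exact Schur complement, so that `A a a = T p p`. -/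

lemma fieldOfValues_lower (hA : SymmPosDef A) (hS : SymmPosDef S) {c : ℝ} (hc : 0 < c)
    (hST : S p p ≤ c * T p p) {w a : X} (ha : A a a = T p p) (hq : S q = T p) :
    1 / 2 * min 1 c⁻¹ * (A w w + S p p) ≤ A (w + a) w + S q p := by
  have hsum : A (w + a) w + S q p = A w w + A a w + T p p := by
    rw [hq, map_add, LinearMap.add_apply]
  have hhalf : 1 / 2 * (A w w + T p p) ≤ A w w + A a w + T p p := by
    have h := hA.nonneg (w + a)
    simp only [map_add, LinearMap.add_apply, hA.symm w a, ha] at h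
    linarith
  have hw : min 1 c⁻¹ * A w w ≤ A w w :=
    mul_le_of_le_one_left (hA.nonneg w) (min_le_left _ _)
  have hp : min 1 c⁻¹ * S p p ≤ T p p :=
    (mul_le_mul_of_nonneg_right (min_le_right _ _) (hS.nonneg p)).trans
      ((inv_mul_le_iff₀ hc).2 hST)
  linarith

lemma fieldOfValues_upper (hA : SymmPosDef A) (hS : SymmPosDef S) (hT : SymmPosDef T) {c : ℝ}
    (hc : 0 ≤ c) (hTS : ∀ p, T p p ≤ c * S p p) {w a : X} (ha : A a a = T p p) (hq : S q = T p) :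
    A (w + a) (w + a) + S q q ≤ max 2 (2 * c) ^ 2 * (A w w + S p p) := by
  have hw : 2 ≤ max 2 (2 * c) ^ 2 := by nlinarith [le_max_left 2 (2 * c)]
  have hp : 2 * c + c ^ 2 ≤ max 2 (2 * c) ^ 2 := by
    nlinarith [le_max_left 2 (2 * c), le_max_right 2 (2 * c)]
  calc A (w + a) (w + a) + S q q
      ≤ (2 * A w w + 2 * A a a) + c ^ 2 * S p p :=
        add_le_add (apply_add_self_le hA.nonneg w a) (hS.apply_self_le_of_apply_eq hT hTS hq)
    _ ≤ 2 * A w w + (2 * c + c ^ 2) * S p p := by linarith [hTS p]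
    _ ≤ max 2 (2 * c) ^ 2 * A w w + max 2 (2 * c) ^ 2 * S p p :=
        add_le_add (mul_le_mul_of_nonneg_right hw (hA.nonneg w))
          (mul_le_mul_of_nonneg_right hp (hS.nonneg p))
    _ = _ := by ring

end FieldOfValues

end LinearAlgebra

section InverseEstimate

variable {V : Type*} [NormedAddCommGroup V] [InnerProductSpace ℝ V] [MeasurableSpace V]
  [BorelSpace V]

lemma map_homothety_euclideanHausdorffMeasure (d : ℕ) (c : V) {t : ℝ} (ht : t ≠ 0) :
    (μHE[d] : Measure V).map (AffineMap.homothety c t) = ‖t‖₊⁻¹ ^ d • μHE[d] := by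
  ext s hs
  rw [Measure.map_apply (AffineMap.homothety_continuous c t).measurable hs,
    euclideanHausdorffMeasure_homothety_preimage d c ht]
  rfl

lemma setIntegral_image_homothety (d : ℕ) (c : V) {t : ℝ} (ht : t ≠ 0) (f : V → ℝ) (s : Set V) :
    ∫ x in AffineMap.homothety c t '' s, f x ∂μHE[d] =
      |t| ^ d * ∫ x in s, f (AffineMap.homothety c t x) ∂μHE[d] := by
  have hemb : MeasurableEmbedding (AffineMap.homothety c t) :=
    (Topology.IsOpenEmbedding.of_continuous_injective_isOpenMap
      (AffineMap.homothety_continuous c t)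
      (AffineMap.homothety_injective c ht)
      (AffineMap.homothety_isOpenMap c t ht)).measurableEmbedding
  have h := hemb.setIntegral_map (μ := μHE[d]) f (AffineMap.homothety c t '' s)
  rw [map_homothety_euclideanHausdorffMeasure d c ht,
    Set.preimage_image_eq s hemb.injective, Measure.restrict_smul,
    integral_smul_nnreal_measure] at h
  rw [← h, NNReal.smul_def, smul_eq_mul, ← mul_assoc]
  simp [ht]

lemma pow_mul_setIntegral_homothety_le {d : ℕ} {T : Set V} (hT : Convex ℝ T) {c : V} (hc : c ∈ T)
    {t : ℝ} (ht : 0 < t) (ht' : t ≤ 1) {f : V → ℝ} (hf : IntegrableOn f T μHE[d])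
    (hf₀ : ∀ x, 0 ≤ f x) :
    t ^ d * ∫ x in T, f (AffineMap.homothety c t x) ∂μHE[d] ≤ ∫ x in T, f x ∂μHE[d] := by
  have hsub : AffineMap.homothety c t '' T ⊆ T := by
    rintro _ ⟨x, hx, rfl⟩
    rw [AffineMap.homothety_eq_lineMap]
    exact hT.lineMap_mem hc hx ⟨ht.le, ht'⟩
  have hmono := setIntegral_mono_set hf (Filter.Eventually.of_forall hf₀) hsub.eventuallyLE
  rwa [setIntegral_image_homothety d c ht.ne', abs_of_pos ht] at hmono

variable [FiniteDimensional ℝ V] {W : Type*} [NormedAddCommGroup W] [NormedSpace ℝ W]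
  [FiniteDimensional ℝ W] {d : ℕ} {T : Set V}

lemma integrableOn_bilin_affine (β : LinearMap.BilinForm ℝ W) (hT : IsCompact T)
    (hfin : μHE[d] T ≠ ⊤) (f g : V →ᵃ[ℝ] W) :
    IntegrableOn (fun x => β (f x) (g x)) T μHE[d] := by
  have hcont : Continuous fun x => β.toContinuousBilinearMap (f x) (g x) := by
    have := f.continuous_of_finiteDimensional
    have := g.continuous_of_finiteDimensional
    fun_prop
  exact hcont.continuousOn.integrableOn_of_subset_isCompact hT hT.measurableSet subset_rfl hfin

/-- The idea: `g c = 2 g (h x) - g x` for the homothety `h` of ratio `1 / 2` and centre `c`. -/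
lemma apply_self_mul_measureReal_le {β : LinearMap.BilinForm ℝ W} (hβ : ∀ x, 0 ≤ β x x)
    (hT : IsCompact T) (hconv : Convex ℝ T) (hfin : μHE[d] T ≠ ⊤) {c : V} (hc : c ∈ T)
    (g : V →ᵃ[ℝ] W) :
    β (g c) (g c) * (μHE[d] : Measure V).real T ≤
      (8 * 2 ^ d + 2) * ∫ x in T, β (g x) (g x) ∂μHE[d] := by
  set h := AffineMap.homothety c (1 / 2 : ℝ) with hh
  have hpoint (x : V) : β (g c) (g c) ≤ 8 * β (g (h x)) (g (h x)) + 2 * β (g x) (g x) := by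
    have hgc : g c = (2 : ℝ) • g (h x) + -g x := by
      rw [hh, AffineMap.homothety_eq_lineMap, AffineMap.apply_lineMap, AffineMap.lineMap_apply]
      simp only [vsub_eq_sub, vadd_eq_add]
      module
    have hle := apply_add_self_le hβ ((2 : ℝ) • g (h x)) (-g x)
    rw [← hgc] at hle
    simp only [map_smul, map_neg, LinearMap.smul_apply, LinearMap.neg_apply, smul_eq_mul,
      neg_neg] at hle
    linarith
  have hint := integrableOn_bilin_affine β hT hfin g g
  have hint' := integrableOn_bilin_affine β hT hfin (g.comp h) (g.comp h)
  have hhalf := pow_mul_setIntegral_homothety_le hconv hc one_half_pos one_half_lt_one.le hint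
    fun x => hβ (g x)
  rw [one_div, inv_pow, inv_mul_le_iff₀ (by positivity), ← one_div] at hhalf
  calc β (g c) (g c) * (μHE[d] : Measure V).real T
      = ∫ _ in T, β (g c) (g c) ∂μHE[d] := by rw [setIntegral_const, smul_eq_mul, mul_comm]
    _ ≤ ∫ x in T, (8 * β (g (h x)) (g (h x)) + 2 * β (g x) (g x)) ∂μHE[d] :=
        setIntegral_mono (integrableOn_const hfin) ((hint'.const_mul 8).add (hint.const_mul 2))
          hpoint
    _ = 8 * ∫ x in T, β (g (h x)) (g (h x)) ∂μHE[d] + 2 * ∫ x in T, β (g x) (g x) ∂μHE[d] := by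
        rw [← integral_const_mul, ← integral_const_mul]
        exact integral_add (hint'.const_mul 8) (hint.const_mul 2)
    _ ≤ (8 * 2 ^ d + 2) * ∫ x in T, β (g x) (g x) ∂μHE[d] := by linarith

end InverseEstimate

lemma sq_mul_apply_self_le {V : Type*} [NormedAddCommGroup V] [NormedSpace ℝ V]
    {β : LinearMap.BilinForm ℝ V} {κ σ : ℝ} (hκ : 0 ≤ κ) (hβ : ∀ x, 0 ≤ β x x)
    (haniso : ∀ x y, β x x * ‖y‖ ^ 2 ≤ κ * (β y y * ‖x‖ ^ 2)) {x y : V} {r s : ℝ}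
    (hx : ‖x‖ ≤ σ * r) (hr : 0 < r) (hy : r * |s| ≤ ‖y‖) :
    s * s * β x x ≤ κ * σ ^ 2 * β y y := by
  obtain rfl | hs := eq_or_ne s 0
  · simpa using mul_nonneg (by positivity) (hβ y)
  have hypos : 0 < ‖y‖ := (by positivity : 0 < r * |s|).trans_le hy
  have hy2 : r ^ 2 * s ^ 2 ≤ ‖y‖ ^ 2 := by
    rw [← sq_abs s, ← mul_pow]
    exact pow_le_pow_left₀ (by positivity) hy 2
  have hx2 : ‖x‖ ^ 2 ≤ σ ^ 2 * r ^ 2 := by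
    rw [← mul_pow]
    exact pow_le_pow_left₀ (norm_nonneg x) hx 2
  refine le_of_mul_le_mul_right ?_ (pow_pos hypos 2)
  calc s * s * β x x * ‖y‖ ^ 2 = s ^ 2 * (β x x * ‖y‖ ^ 2) := by ring
    _ ≤ s ^ 2 * (κ * (β y y * (σ ^ 2 * r ^ 2))) := by
        refine mul_le_mul_of_nonneg_left ((haniso x y).trans ?_) (sq_nonneg s)
        have := hβ y
        gcongr
    _ = κ * σ ^ 2 * β y y * (r ^ 2 * s ^ 2) := by ring
    _ ≤ κ * σ ^ 2 * β y y * ‖y‖ ^ 2 := by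
        have := hβ y
        gcongr

section Simplex

variable {ι V : Type*} [NormedAddCommGroup V] [InnerProductSpace ℝ V] {v : ι → V} {k : ι}

section Measure

lemma isCompact_simplex [Finite ι] (v : ι → V) : IsCompact (convexHull ℝ (Set.range v)) :=
  (Set.finite_range v).isCompact_convexHull ℝ

variable [Fintype ι] [MeasurableSpace V] [BorelSpace V] {d : ℕ}

/-- The affine span of the simplex is identified isometrically with its direction, where the
`d`-dimensional Hausdorff measure is the Lebesgue measure. -/
lemma simplex_measure_ne (hv : AffineIndependent ℝ v) (hd : Fintype.card ι = d + 1) :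
    μHE[d] (convexHull ℝ (Set.range v)) ≠ 0 ∧ μHE[d] (convexHull ℝ (Set.range v)) ≠ ⊤ := by
  have : Nonempty ι := Fintype.card_pos_iff.1 (by omega)
  obtain ⟨i₀⟩ := this
  obtain rfl := hv.finrank_vectorSpan hd
  set U := vectorSpan ℝ (Set.range v)
  let w (i : ι) : U := ⟨v i - v i₀, vsub_mem_vectorSpan ℝ ⟨i, rfl⟩ ⟨i₀, rfl⟩⟩
  let f : U →ᵃ[ℝ] V := U.subtype.toAffineMap + AffineMap.const ℝ U (v i₀)
  have hf : Isometry f := Isometry.of_dist_eq fun x y => dist_add_right _ _ _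
  have hfw : f ∘ w = v := funext fun i => sub_add_cancel _ _
  have hw : AffineIndependent ℝ w := by
    rw [← f.affineIndependent_iff hf.injective, hfw]
    exact hv
  have hfin : FiniteDimensional ℝ U := inferInstance
  have hspan : affineSpan ℝ (Set.range w) = ⊤ :=
    hw.affineSpan_eq_top_iff_card_eq_finrank_add_one.2 hd
  rw [← hfw, Set.range_comp, ← f.image_convexHull, hf.euclideanHausdorffMeasure_image]
  exact ⟨(Measure.measure_pos_of_nonempty_interior _
    (interior_convexHull_nonempty_iff_affineSpan_eq_top.2 hspan)).ne',
    (isCompact_simplex w).measure_ne_top⟩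

lemma simplex_measureReal_pos (hv : AffineIndependent ℝ v) (hd : Fintype.card ι = d + 1) :
    0 < (μHE[d] : Measure V).real (convexHull ℝ (Set.range v)) :=
  ENNReal.toReal_pos (simplex_measure_ne hv hd).1 (simplex_measure_ne hv hd).2

end Measure

section Barycentric

/-- `l` is the differential of the barycentric coordinate of the vertex `k`. -/
lemma exists_barycentric_gradient (hv : AffineIndependent ℝ v) (k : ι) :
    ∃ l : V →ₗ[ℝ] ℝ, ∀ j, j ≠ k → l (v j - v k) = -1 := by
  have hli := (affineIndependent_iff_linearIndependent_vsub ℝ v k).1 hv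
  obtain ⟨l, hl⟩ := LinearMap.exists_extend ((Module.Basis.span hli).constr ℝ fun _ => (-1 : ℝ))
  refine ⟨l, fun j hj => ?_⟩
  have hlj := LinearMap.congr_fun hl (Module.Basis.span hli ⟨j, hj⟩)
  rw [Module.Basis.constr_basis] at hlj
  simpa [Module.Basis.span_apply] using hlj

variable {l : V →ₗ[ℝ] ℝ}

lemma barycentric_gradient_mem_Icc (hl : ∀ j, j ≠ k → l (v j - v k) = -1) {x : V}
    (hx : x ∈ convexHull ℝ (Set.range v)) : l (x - v k) ∈ Set.Icc (-1) 0 := by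
  have hsub : convexHull ℝ (Set.range v) ⊆ l ⁻¹' Set.Icc (l (v k) - 1) (l (v k)) := by
    refine convexHull_min ?_ ((convex_Icc _ _).linear_preimage l)
    rintro _ ⟨j, rfl⟩
    obtain rfl | hj := eq_or_ne j k
    · simp
    · have := hl j hj
      rw [map_sub] at this
      constructor <;> linarith
  obtain ⟨h₁, h₂⟩ := hsub hx
  rw [map_sub]
  constructor <;> linarith

lemma mul_abs_barycentric_gradient_le (hl : ∀ j, j ≠ k → l (v j - v k) = -1) {c : V}
    (hc : c ∈ affineSpan ℝ (Set.range v)) {r : ℝ} (hr : 0 ≤ r)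
    (hball : Metric.closedBall c r ∩ affineSpan ℝ (Set.range v) ⊆ convexHull ℝ (Set.range v))
    {w : V} (hw : w ∈ vectorSpan ℝ (Set.range v)) : r * |l w| ≤ ‖w‖ := by
  obtain rfl | hw₀ := eq_or_ne w 0
  · simp
  have hnorm : 0 < ‖w‖ := norm_pos_iff.2 hw₀
  have hdir : (r / ‖w‖) • w ∈ (affineSpan ℝ (Set.range v)).direction := by
    rw [direction_affineSpan]
    exact Submodule.smul_mem _ _ hw
  have hdist : (r / ‖w‖) • w +ᵥ c ∈ Metric.closedBall c r := by
    rw [Metric.mem_closedBall, dist_vadd_left, norm_smul, norm_div, norm_norm,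
      Real.norm_of_nonneg hr, div_mul_cancel₀ _ hnorm.ne']
  obtain ⟨h₁, h₁'⟩ :=
    barycentric_gradient_mem_Icc hl (hball ⟨Metric.mem_closedBall_self hr, hc⟩)
  obtain ⟨h₂, h₂'⟩ := barycentric_gradient_mem_Icc hl
    (hball ⟨hdist, AffineSubspace.vadd_mem_of_mem_direction hdir hc⟩)
  rw [vadd_eq_add, add_sub_assoc, map_add, map_smul, smul_eq_mul] at h₂ h₂'
  have habs : |r / ‖w‖ * l w| ≤ 1 := abs_le.2 ⟨by linarith, by linarith⟩
  rwa [abs_mul, abs_of_nonneg (by positivity), div_mul_eq_mul_div, div_le_one hnorm] at habs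

end Barycentric

section RaviartThomas

variable [Fintype ι]

/-- The Raviart-Thomas field `∑ j, a j (x - v j)` on the simplex with the vertices `v j`, normalised
without the factors `|f| / (d |T|)` of the basis functions. -/
noncomputable def rtField (v : ι → V) (a : ι → ℝ) : V →ᵃ[ℝ] V where
  toFun x := ∑ j, a j • (x - v j)
  linear := (∑ j, a j) • LinearMap.id
  map_vadd' x w := by
    simp only [vadd_eq_add, add_sub_assoc, smul_add, Finset.sum_add_distrib, ← Finset.sum_smul]
    rfl

lemma rtField_apply (v : ι → V) (a : ι → ℝ) (x : V) : rtField v a x = ∑ j, a j • (x - v j) :=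
  rfl

lemma rtField_mem_vectorSpan (a : ι → ℝ) (j : ι) :
    rtField v a (v j) ∈ vectorSpan ℝ (Set.range v) := by
  rw [rtField_apply]
  exact Submodule.sum_mem _ fun i _ =>
    Submodule.smul_mem _ _ (vsub_mem_vectorSpan ℝ ⟨j, rfl⟩ ⟨i, rfl⟩)

lemma barycentric_gradient_rtField {l : V →ₗ[ℝ] ℝ} (hl : ∀ j, j ≠ k → l (v j - v k) = -1)
    (a : ι → ℝ) {j : ι} (hj : j ≠ k) : l (rtField v a (v j)) = -a k := by
  rw [rtField_apply, map_sum, Finset.sum_eq_single k]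
  · rw [map_smul, hl j hj, smul_eq_mul, mul_neg_one]
  · intro i _ hi
    have hj' := hl j hj
    have hi' := hl i hi
    rw [map_sub] at hj' hi'
    rw [map_smul, map_sub, smul_eq_mul, show l (v j) - l (v i) = 0 by linarith, mul_zero]
  · simp

lemma exists_rtField_apply_ne_zero [Nontrivial ι] (hv : AffineIndependent ℝ v) {a : ι → ℝ}
    (ha : a ≠ 0) : ∃ j, rtField v a (v j) ≠ 0 := by
  obtain ⟨k, hk⟩ := Function.ne_iff.1 ha
  obtain ⟨j, hj⟩ := exists_ne k
  obtain ⟨l, hl⟩ := exists_barycentric_gradient hv k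
  refine ⟨j, fun h => hk ?_⟩
  have hjk := barycentric_gradient_rtField hl a hj
  rwa [h, map_zero, zero_eq_neg] at hjk

variable [MeasurableSpace V] [BorelSpace V] [FiniteDimensional ℝ V] {d : ℕ}
  {β : LinearMap.BilinForm ℝ V}

/-- The local mass matrix `∫_T β (x - v k) (x - v l)` of the fields `x - v k` on the simplex `T`
with the vertices `v k`. -/
noncomputable def vertexMass (d : ℕ) (v : ι → V) (β : LinearMap.BilinForm ℝ V) (k l : ι) : ℝ :=
  ∫ x in convexHull ℝ (Set.range v), β (x - v k) (x - v l) ∂μHE[d]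

lemma sum_vertexMass (hv : AffineIndependent ℝ v) (hd : Fintype.card ι = d + 1)
    (β : LinearMap.BilinForm ℝ V) (a : ι → ℝ) :
    ∑ k, ∑ l, a k * a l * vertexMass d v β k l =
      ∫ x in convexHull ℝ (Set.range v), β (rtField v a x) (rtField v a x) ∂μHE[d] := by
  have hint (k l : ι) : IntegrableOn (fun x => a k * a l * β (x - v k) (x - v l))
      (convexHull ℝ (Set.range v)) μHE[d] :=
    (integrableOn_bilin_affine β (isCompact_simplex v) (simplex_measure_ne hv hd).2
      (AffineMap.id ℝ V - AffineMap.const ℝ V (v k))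
      (AffineMap.id ℝ V - AffineMap.const ℝ V (v l))).const_mul _
  have hexpand (x : V) : β (rtField v a x) (rtField v a x) =
      ∑ k, ∑ l, a k * a l * β (x - v k) (x - v l) := by
    simp only [rtField_apply, map_sum, map_smul, LinearMap.sum_apply, LinearMap.smul_apply,
      smul_eq_mul, Finset.mul_sum, mul_assoc]
    rw [Finset.sum_comm]
    exact Finset.sum_congr rfl fun k _ => Finset.sum_congr rfl fun l _ => mul_left_comm _ _ _
  simp_rw [hexpand, vertexMass, ← integral_const_mul]
  rw [integral_finsetSum _ fun k _ => integrable_finsetSum _ fun l _ => hint k l]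
  exact Finset.sum_congr rfl fun k _ => (integral_finsetSum _ fun l _ => hint k l).symm

lemma apply_rtField_mul_measureReal_le (hv : AffineIndependent ℝ v) (hd : Fintype.card ι = d + 1)
    (hβ : ∀ x, 0 ≤ β x x) (a : ι → ℝ) (j : ι) :
    β (rtField v a (v j)) (rtField v a (v j)) *
        (μHE[d] : Measure V).real (convexHull ℝ (Set.range v)) ≤
      (8 * 2 ^ d + 2) * ∑ k, ∑ l, a k * a l * vertexMass d v β k l := by
  rw [sum_vertexMass hv hd]
  exact apply_self_mul_measureReal_le hβ (isCompact_simplex v) (convex_convexHull ℝ _)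
    (simplex_measure_ne hv hd).2 (subset_convexHull ℝ _ ⟨j, rfl⟩) _

lemma sum_vertexMass_pos [Nontrivial ι] (hv : AffineIndependent ℝ v)
    (hd : Fintype.card ι = d + 1) (hβ : SymmPosDef β) {a : ι → ℝ} (ha : a ≠ 0) :
    0 < ∑ k, ∑ l, a k * a l * vertexMass d v β k l := by
  obtain ⟨j, hj⟩ := exists_rtField_apply_ne_zero hv ha
  refine pos_of_mul_pos_right ((mul_pos (hβ.pos _ hj) (simplex_measureReal_pos hv hd)).trans_le
    (apply_rtField_mul_measureReal_le hv hd hβ.nonneg a j)) (by positivity)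

/-- The field `a k (x - v k)` has size at most `|a k| diam T`, while at a vertex other than `v k`
the normal component of `∑ j, a j (x - v j)` on the facet opposite to `v k` is at least `|a k|`
times the inradius. -/
lemma mul_vertexMass_self_le [Nontrivial ι] (hv : AffineIndependent ℝ v)
    (hd : Fintype.card ι = d + 1) {κ σ : ℝ} (hκ : 0 ≤ κ) (hβ : ∀ x, 0 ≤ β x x)
    (haniso : ∀ x y, β x x * ‖y‖ ^ 2 ≤ κ * (β y y * ‖x‖ ^ 2)) {c : V}
    (hc : c ∈ affineSpan ℝ (Set.range v)) {r : ℝ} (hr : 0 < r)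
    (hball : Metric.closedBall c r ∩ affineSpan ℝ (Set.range v) ⊆ convexHull ℝ (Set.range v))
    (hσ : Metric.diam (convexHull ℝ (Set.range v)) ≤ σ * r) (a : ι → ℝ) (k : ι) :
    a k * a k * vertexMass d v β k k ≤
      κ * σ ^ 2 * (8 * 2 ^ d + 2) * ∑ k, ∑ l, a k * a l * vertexMass d v β k l := by
  set T := convexHull ℝ (Set.range v)
  obtain ⟨j, hj⟩ := exists_ne k
  obtain ⟨l, hl⟩ := exists_barycentric_gradient hv k
  set u := rtField v a (v j)
  have hak : r * |a k| ≤ ‖u‖ := by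
    rw [← abs_neg, ← barycentric_gradient_rtField hl a hj]
    exact mul_abs_barycentric_gradient_le hl hc hr.le hball (rtField_mem_vectorSpan a j)
  have hpoint {x : V} (hx : x ∈ T) :
      a k * a k * β (x - v k) (x - v k) ≤ κ * σ ^ 2 * β u u := by
    refine sq_mul_apply_self_le hκ hβ haniso ?_ hr hak
    rw [← dist_eq_norm]
    exact (Metric.dist_le_diam_of_mem (isCompact_simplex v).isBounded hx
      (subset_convexHull ℝ _ ⟨k, rfl⟩)).trans hσ
  have hfin := (simplex_measure_ne hv hd).2
  calc a k * a k * vertexMass d v β k k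
      = ∫ x in T, a k * a k * β (x - v k) (x - v k) ∂μHE[d] := (integral_const_mul _ _).symm
    _ ≤ ∫ _ in T, κ * σ ^ 2 * β u u ∂μHE[d] := by
        refine setIntegral_mono_on (Integrable.const_mul ?_ _) (integrableOn_const hfin)
          (isCompact_simplex v).measurableSet fun x hx => hpoint hx
        exact integrableOn_bilin_affine β (isCompact_simplex v) hfin
          (AffineMap.id ℝ V - AffineMap.const ℝ V (v k))
          (AffineMap.id ℝ V - AffineMap.const ℝ V (v k))
    _ = κ * σ ^ 2 * (β u u * (μHE[d] : Measure V).real T) := by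
        rw [setIntegral_const, smul_eq_mul]
        ring
    _ ≤ κ * σ ^ 2 * ((8 * 2 ^ d + 2) * ∑ k, ∑ l, a k * a l * vertexMass d v β k l) :=
        mul_le_mul_of_nonneg_left (apply_rtField_mul_measureReal_le hv hd hβ a j) (by positivity)
    _ = _ := by ring

end RaviartThomas

end Simplex

section Tensor

variable {m : Type*} [Fintype m] [DecidableEq m] {K : Matrix m m ℝ}

/-- The bilinear form `(M x, y)` of a matrix `M`. -/
noncomputable def matrixForm (M : Matrix m m ℝ) : LinearMap.BilinForm ℝ (EuclideanSpace ℝ m) :=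
  innerₗ (EuclideanSpace ℝ m) ∘ₗ Matrix.toEuclideanLin M

lemma matrixForm_apply (M : Matrix m m ℝ) (x y : EuclideanSpace ℝ m) :
    matrixForm M x y = inner ℝ (Matrix.toEuclideanLin M x) y :=
  rfl

lemma symmPosDef_matrixForm (hK : K.PosDef) : SymmPosDef (matrixForm K) where
  symm x y := by
    rw [matrixForm_apply, matrixForm_apply, Matrix.isSymmetric_toEuclideanLin_iff.2 hK.1 x y,
      real_inner_comm]
  pos x hx := by
    have := hK.dotProduct_mulVec_pos (x := x.ofLp) (by simpa using hx)
    simpa [matrixForm_apply, EuclideanSpace.inner_eq_star_dotProduct, dotProduct_comm] using this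

lemma symmPosDef_innerₗ (V : Type*) [NormedAddCommGroup V] [InnerProductSpace ℝ V] :
    SymmPosDef (innerₗ V) where
  symm x y := real_inner_comm y x
  pos _ hx := real_inner_self_pos.2 hx

lemma matrixForm_apply_inv (hK : IsUnit K.det) (x : EuclideanSpace ℝ m) :
    matrixForm K (Matrix.toEuclideanLin K⁻¹ x) = innerₗ _ x := by
  have hinv : Matrix.toEuclideanLin K (Matrix.toEuclideanLin K⁻¹ x) = x := by
    ext i
    simp [Matrix.toLpLin_apply, Matrix.mulVec_mulVec, Matrix.mul_nonsing_inv _ hK]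
  exact congrArg (innerₗ _) hinv

/-- The eigenvalues of `K⁻¹` are the inverses of those of `K`, hence have the same ratio. -/
lemma matrixForm_inv_anisotropy (hK : K.PosDef) {κ : ℝ}
    (h : ∀ ξ η, matrixForm K ξ ξ * ‖η‖ ^ 2 ≤ κ * (matrixForm K η η * ‖ξ‖ ^ 2))
    (x y : EuclideanSpace ℝ m) :
    matrixForm K⁻¹ x x * ‖y‖ ^ 2 ≤ κ * (matrixForm K⁻¹ y y * ‖x‖ ^ 2) := by
  have hform := symmPosDef_matrixForm hK
  have hinner := symmPosDef_innerₗ (EuclideanSpace ℝ m)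
  have hsq (z : EuclideanSpace ℝ m) : innerₗ _ z z = ‖z‖ ^ 2 := real_inner_self_eq_norm_sq z
  have hdual (z : EuclideanSpace ℝ m) := matrixForm_apply_inv hK.det_pos.ne'.isUnit z
  have hinv (z : EuclideanSpace ℝ m) :
      innerₗ _ z (Matrix.toEuclideanLin K⁻¹ z) = matrixForm K⁻¹ z z :=
    real_inner_comm (Matrix.toEuclideanLin K⁻¹ z) z
  have hmixed (ξ z : EuclideanSpace ℝ m) :
      matrixForm K ξ ξ * matrixForm K⁻¹ z z ≤ κ * ‖ξ‖ ^ 2 * ‖z‖ ^ 2 := by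
    have hle := hform.mul_apply_inv_le hinner (a := matrixForm K ξ ξ) (b := κ * ‖ξ‖ ^ 2)
      (hform.nonneg ξ) (fun η => by rw [hsq]; linarith [h ξ η]) (hdual z) rfl
    rwa [hinv, hsq] at hle
  have hle := hinner.mul_apply_inv_le hform (a := matrixForm K⁻¹ x x) (b := κ * ‖x‖ ^ 2)
    ((symmPosDef_matrixForm hK.inv).nonneg x) (fun ξ => by rw [hsq]; linarith [hmixed ξ x])
    rfl (hdual y)
  rw [hinv, hsq] at hle
  linarith

end Tensor

lemma sum_measureReal_inter {X ι : Type*} [MeasurableSpace X] {μ : Measure X} {s : Finset ι}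
    {f : ι → Set X} (hf : ∀ i ∈ s, MeasurableSet (f i))
    (hnull : ∀ i ∈ s, ∀ j ∈ s, i ≠ j → μ (f i ∩ f j) = 0) {A : Set X} (hA : MeasurableSet A)
    (hAfin : μ A ≠ ⊤) (hcover : A ⊆ ⋃ i ∈ s, f i) :
    ∑ i ∈ s, μ.real (f i ∩ A) = μ.real A := by
  have hdisjoint : (s : Set ι).Pairwise (Function.onFun (AEDisjoint μ) fun i => f i ∩ A) :=
    fun i hi j hj hij => measure_mono_null
      (Set.inter_subset_inter Set.inter_subset_left Set.inter_subset_left) (hnull i hi j hj hij)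
  simp_rw [measureReal_def]
  rw [← ENNReal.toReal_sum fun i _ =>
      ne_top_of_le_ne_top hAfin (measure_mono Set.inter_subset_right),
    ← measure_biUnion_finset₀ hdisjoint fun i hi => ((hf i hi).inter hA).nullMeasurableSet,
    ← Set.iUnion₂_inter, Set.inter_eq_right.2 hcover]

lemma facet_measureReal_pos {V : Type*} [NormedAddCommGroup V] [InnerProductSpace ℝ V]
    [MeasurableSpace V] [BorelSpace V] {d : ℕ} {v : Fin (d + 1) → V} (hd : d ≠ 0)
    (hv : AffineIndependent ℝ v) (k : Fin (d + 1)) :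
    0 < (μHE[d - 1] : Measure V).real (convexHull ℝ (v '' {k}ᶜ)) := by
  obtain ⟨d, rfl⟩ := Nat.exists_eq_succ_of_ne_zero hd
  rw [← Fin.range_succAbove, ← Set.range_comp]
  exact simplex_measureReal_pos (hv.comp_embedding k.succAboveEmb) (by simp)

namespace Mesh

variable {n : ℕ} (G : Mesh n) {i : G.Sub}

lemma dim_le (i : G.Sub) : G.dim i ≤ n := by
  obtain ⟨T⟩ := G.nonemptyCell i
  have hcard := (G.vert_indep i T).card_le_finrank_succ
  have hrank := Submodule.finrank_le (vectorSpan ℝ (Set.range (G.vert i T)))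
  rw [Fintype.card_fin] at hcard
  rw [finrank_euclideanSpace_fin] at hrank
  lia

lemma dim_ne_zero_of_kind_ne {F : G.Cell i × Fin (G.dim i + 1)} (h : G.kind i F ≠ .neumann) :
    G.dim i ≠ 0 :=
  fun h0 => h (G.kind_point i F h0)

lemma cellVol_pos (T : G.Cell i) : 0 < G.cellVol i T :=
  simplex_measureReal_pos (G.vert_indep i T) (by simp)

lemma facetVol_pos (hi : G.dim i ≠ 0) (T : G.Cell i) (k : Fin (G.dim i + 1)) :
    0 < G.facetVol i T k :=
  facet_measureReal_pos hi (G.vert_indep i T) k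

lemma rtCoef_pos (hi : G.dim i ≠ 0) (T : G.Cell i) (k : Fin (G.dim i + 1)) :
    0 < G.rtCoef i T k :=
  div_pos (G.facetVol_pos hi T k)
    (mul_pos (Nat.cast_pos.2 (Nat.pos_of_ne_zero hi)) (G.cellVol_pos T))

lemma rtCoef_eq_zero (hi : G.dim i = 0) (T : G.Cell i) (k : Fin (G.dim i + 1)) :
    G.rtCoef i T k = 0 := by
  simp [rtCoef, hi]

lemma facetVol_eq_of_glued {F F' : G.Cell i × Fin (G.dim i + 1)} (h : G.kind i F = .glued F') :
    G.facetVol i F.1 F.2 = G.facetVol i F'.1 F'.2 := by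
  simp only [facetVol, facetSet, G.glued_vert i F F' h]

lemma sum_mul_divCell (p : G.Cell i → ℝ) {u : G.Flux} (hu : u ∈ G.Vh) :
    ∑ T, p T * (G.divCell u i T * G.cellVol i T) =
      ∑ F : G.Cell i × Fin (G.dim i + 1), p F.1 * (u i F.1 F.2 * G.facetVol i F.1 F.2) := by
  rw [Fintype.sum_prod_type]
  refine Finset.sum_congr rfl fun T _ => ?_
  simp only [← Finset.mul_sum, divCell, Finset.sum_mul]
  congr 1
  refine Finset.sum_congr rfl fun k _ => ?_
  by_cases hi : G.dim i = 0
  · simp [hu.2 i (T, k) (G.kind_point i _ hi)]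
  · have hT := G.cellVol_pos T
    have hdim : (G.dim i : ℝ) ≠ 0 := Nat.cast_ne_zero.2 hi
    rw [rtCoef]
    field_simp

lemma total_mk_zero (u : G.V0h) : G.total (u, 0) = u := by
  simp [total]

lemma total_zero_mk (μ : G.Lam) : G.total (0, μ) = G.Rh μ := by
  simp [total]

lemma total_mem_Vh (r : G.Wh) : G.total r ∈ G.Vh :=
  G.Vh.add_mem r.1.2.1 (G.Rh r.2).2

/-- The facet glued to a given facet of the mesh of a subdomain, or the facet itself if it is not
glued to another one. -/
def partner (F : G.Cell i × Fin (G.dim i + 1)) : G.Cell i × Fin (G.dim i + 1) :=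
  match G.kind i F with
  | .glued F' => F'
  | _ => F

lemma partner_involutive : Function.Involutive (G.partner (i := i)) := by
  intro F
  cases h : G.kind i F with
  | glued F' => simp [partner, h, G.glued_symm i F F' h]
  | _ => simp [partner, h]

/-- The discrete gradient of a pressure: the flux in `V_{0h}` whose normal component is the jump of
the pressure on interior facets, the pressure itself on Dirichlet facets, and zero on the other
facets. -/
def pressureJump (p : G.Qh) : G.Flux := fun i T k =>
  match G.kind i (T, k) with
  | .glued F' => p i T - p i F'.1
  | .dirichlet => p i T
  | _ => 0

lemma pressureJump_mem_V0h (p : G.Qh) : G.pressureJump p ∈ G.V0h := by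
  refine ⟨⟨fun i F F' h => ?_, fun i F h => ?_⟩, fun i F e h => ?_⟩
  · simp [pressureJump, h, G.glued_symm i F F' h]
  · simp [pressureJump, h]
  · simp [pressureJump, h]

-- On a pair of glued facets the two summands `p [p]` and `p' [p']` add up to `[p]²`.
lemma sum_pressureJump_sq_le (p : G.Qh) (i : G.Sub) :
    ∑ F : G.Cell i × Fin (G.dim i + 1), G.pressureJump p i F.1 F.2 ^ 2 * G.facetVol i F.1 F.2 ≤
      2 * ∑ F : G.Cell i × Fin (G.dim i + 1),
        p i F.1 * (G.pressureJump p i F.1 F.2 * G.facetVol i F.1 F.2) := by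
  set f := fun F : G.Cell i × Fin (G.dim i + 1) =>
    p i F.1 * (G.pressureJump p i F.1 F.2 * G.facetVol i F.1 F.2) with hf
  have hpair : ∑ F, f (G.partner F) = ∑ F, f F :=
    Equiv.sum_comp G.partner_involutive.toPerm f
  rw [two_mul]
  nth_rewrite 2 [← hpair]
  rw [← Finset.sum_add_distrib]
  refine Finset.sum_le_sum fun F _ => ?_
  cases h : G.kind i F with
  | glued F' =>
    have h' := G.glued_symm i F F' h
    simp only [hf, partner, pressureJump, h, h', G.facetVol_eq_of_glued h]
    exact le_of_eq (by ring)
  | dirichlet =>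
    have hpos := G.facetVol_pos (G.dim_ne_zero_of_kind_ne (F := F) (by simp [h])) F.1 F.2
    simp only [hf, partner, pressureJump, h]
    nlinarith [mul_nonneg (sq_nonneg (p i F.1)) hpos.le]
  | _ => simp [hf, partner, pressureJump, h]

lemma sum_cellSet_inter_mcellSet (e : G.Ifc) (m : G.MCell e) :
    ∑ T, (μHE[G.dim (G.lower e)] : Measure (E n)).real
      (G.cellSet (G.lower e) T ∩ G.mcellSet e m) =
      (μHE[G.dim (G.lower e)] : Measure (E n)).real (G.mcellSet e m) := by
  refine sum_measureReal_inter (fun T _ => (isCompact_simplex _).measurableSet)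
    (fun T _ T' _ h => G.cell_nonoverlap _ T T' h) (isCompact_simplex _).measurableSet
    (simplex_measure_ne (G.mvert_indep e m) (by simp)).2 ?_
  simp only [Finset.mem_univ, Set.iUnion_true]
  exact (Set.subset_iUnion (G.mcellSet e) m).trans (G.mortar_subset e)

open Classical in
lemma sum_facetSet_inter_mcellSet (e : G.Ifc) (m : G.MCell e) :
    ∑ F with G.kind (G.upper e) F = .mortar e, (μHE[G.dim (G.lower e)] : Measure (E n)).real
      (G.facetSet (G.upper e) F.1 F.2 ∩ G.mcellSet e m) =
      (μHE[G.dim (G.lower e)] : Measure (E n)).real (G.mcellSet e m) := by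
  refine sum_measureReal_inter
    (f := fun F : G.Cell (G.upper e) × Fin (G.dim (G.upper e) + 1) =>
      G.facetSet (G.upper e) F.1 F.2)
    (fun F _ => ((Set.toFinite _).isCompact_convexHull ℝ).measurableSet)
    (fun F hF F' hF' => G.mortar_nonoverlap e F F' (Finset.mem_filter.1 hF).2
      (Finset.mem_filter.1 hF').2)
    (isCompact_simplex _).measurableSet (simplex_measure_ne (G.mvert_indep e m) (by simp)).2 ?_
  simp only [Finset.mem_filter, Finset.mem_univ, true_and]
  exact (Set.subset_iUnion (G.mcellSet e) m).trans (G.mortar_cover e).superset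

open Classical in
lemma Rh_mul_facetVol (μ : G.Lam) (F : G.Cell i × Fin (G.dim i + 1)) :
    (G.Rh μ : G.Flux) i F.1 F.2 * G.facetVol i F.1 F.2 =
      ∑ e, if G.kind i F = .mortar e then ∑ m, μ e m *
        (μHE[G.dim (G.lower e)] : Measure (E n)).real (G.facetSet i F.1 F.2 ∩ G.mcellSet e m)
      else 0 := by
  cases h : G.kind i F with
  | mortar e =>
    have hpos := G.facetVol_pos (G.dim_ne_zero_of_kind_ne (F := F) (by simp [h])) F.1 F.2
    simp [Rh, h, mortarProj, hpos.ne']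
  | _ => simp [Rh, h]

lemma sum_Rh_mul_facetVol (μ : G.Lam) (a : G.Sub → ℝ) :
    ∑ i, ∑ F : G.Cell i × Fin (G.dim i + 1),
        a i * ((G.Rh μ : G.Flux) i F.1 F.2 * G.facetVol i F.1 F.2) =
      ∑ e, a (G.upper e) *
        ∑ m, μ e m * (μHE[G.dim (G.lower e)] : Measure (E n)).real (G.mcellSet e m) := by
  classical
  simp_rw [Rh_mul_facetVol, Finset.mul_sum (s := Finset.univ (α := G.Ifc))]
  simp_rw [Finset.sum_comm (t := Finset.univ (α := G.Ifc))]
  refine Finset.sum_congr rfl fun e _ => ?_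
  rw [Finset.sum_eq_single (G.upper e) (fun i _ hi => Finset.sum_eq_zero fun F _ => ?_) (by simp)]
  · simp_rw [← Finset.mul_sum, ← Finset.sum_filter,
      Finset.sum_comm (t := Finset.univ (α := G.MCell e)),
      ← Finset.mul_sum, sum_facetSet_inter_mcellSet]
  · rw [if_neg fun h => hi (G.kind_mortar i F e h).symm, mul_zero]

lemma divPairing_mortar_const (μ : G.Lam) (a : G.Sub → ℝ) :
    G.divPairing (0, μ) (fun i _ => a i) = ∑ e, (a (G.upper e) - a (G.lower e)) *
      ∑ m, μ e m * (μHE[G.dim (G.lower e)] : Measure (E n)).real (G.mcellSet e m) := by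
  have hlower (e : G.Ifc) : ∑ T, ∑ m, a (G.lower e) * (-(μ e m) *
      (μHE[G.dim (G.lower e)] : Measure (E n)).real (G.cellSet (G.lower e) T ∩ G.mcellSet e m)) =
      -(a (G.lower e) *
        ∑ m, μ e m * (μHE[G.dim (G.lower e)] : Measure (E n)).real (G.mcellSet e m)) := by
    rw [Finset.sum_comm]
    simp_rw [← Finset.mul_sum, sum_cellSet_inter_mcellSet, neg_mul, Finset.sum_neg_distrib,
      mul_neg]
  rw [divPairing, total_zero_mk]
  simp_rw [G.sum_mul_divCell _ (G.Rh μ).2, sum_Rh_mul_facetVol, hlower, sub_mul,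
    Finset.sum_sub_distrib, Finset.sum_neg_distrib, sub_eq_add_neg]

section Kernel

variable {G} {p : G.Qh}

lemma divPairing_eq_zero (hp : G.opBT p = 0) (r : G.Wh) : G.divPairing r p = 0 :=
  neg_eq_zero.1 (LinearMap.congr_fun hp r)

lemma pressureJump_eq_zero (hp : G.opBT p = 0) (F : G.Cell i × Fin (G.dim i + 1)) :
    G.pressureJump p i F.1 F.2 = 0 := by
  by_cases hi : G.dim i = 0
  · simp [pressureJump, G.kind_point i F hi]
  have hwork : ∑ j, ∑ H : G.Cell j × Fin (G.dim j + 1),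
      p j H.1 * (G.pressureJump p j H.1 H.2 * G.facetVol j H.1 H.2) = 0 := by
    have hdiv := divPairing_eq_zero hp (⟨_, G.pressureJump_mem_V0h p⟩, 0)
    rw [divPairing, total_mk_zero] at hdiv
    simpa [G.sum_mul_divCell _ (G.pressureJump_mem_V0h p).1] using hdiv
  have hnonneg (j : G.Sub) (H : G.Cell j × Fin (G.dim j + 1)) :
      0 ≤ G.pressureJump p j H.1 H.2 ^ 2 * G.facetVol j H.1 H.2 :=
    mul_nonneg (sq_nonneg _) measureReal_nonneg
  have hsum_le : ∑ j, ∑ H : G.Cell j × Fin (G.dim j + 1),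
      G.pressureJump p j H.1 H.2 ^ 2 * G.facetVol j H.1 H.2 ≤ 0 := by
    refine (Finset.sum_le_sum fun j _ => G.sum_pressureJump_sq_le p j).trans_eq ?_
    rw [← Finset.mul_sum, hwork, mul_zero]
  have hsub : ∑ H : G.Cell i × Fin (G.dim i + 1),
      G.pressureJump p i H.1 H.2 ^ 2 * G.facetVol i H.1 H.2 ≤ 0 :=
    (Finset.single_le_sum (f := fun j => ∑ H : G.Cell j × Fin (G.dim j + 1),
        G.pressureJump p j H.1 H.2 ^ 2 * G.facetVol j H.1 H.2)
      (fun j _ => Finset.sum_nonneg fun H _ => hnonneg j H) (Finset.mem_univ i)).trans hsum_le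
  have hF := (Finset.single_le_sum (fun H _ => hnonneg i H) (Finset.mem_univ F)).trans hsub
  have hpos := G.facetVol_pos hi F.1 F.2
  exact pow_eq_zero_iff two_ne_zero |>.1
    ((nonpos_of_mul_nonpos_left hF hpos).antisymm (sq_nonneg _))

lemma pressure_eq_of_glued (hp : G.opBT p = 0) {F F' : G.Cell i × Fin (G.dim i + 1)}
    (h : G.kind i F = .glued F') : p i F.1 = p i F'.1 := by
  have hjump := pressureJump_eq_zero hp F
  simp only [pressureJump, h] at hjump
  exact sub_eq_zero.1 hjump

lemma pressure_eq_zero_of_dirichlet (hp : G.opBT p = 0) {F : G.Cell i × Fin (G.dim i + 1)}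
    (h : G.kind i F = .dirichlet) : p i F.1 = 0 := by
  have hjump := pressureJump_eq_zero hp F
  simpa only [pressureJump, h] using hjump

lemma exists_pressure_eq_const (hp : G.opBT p = 0) : ∃ a : G.Sub → ℝ, p = fun i _ => a i := by
  refine ⟨fun i => p i (Classical.arbitrary _), ?_⟩
  funext i T
  induction G.sub_connected i T (Classical.arbitrary _)
    using Relation.ReflTransGen.head_induction_on with
  | refl => rfl
  | head hstep _ ih =>
    obtain ⟨k, k', hglued⟩ := hstep
    exact (pressure_eq_of_glued hp hglued).trans ih

lemma pressure_upper_eq_lower {a : G.Sub → ℝ} (ha : G.opBT (fun i _ => a i) = 0) (e : G.Ifc) :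
    a (G.upper e) = a (G.lower e) := by
  have hmcell (e : G.Ifc) (m : G.MCell e) :
      0 < (μHE[G.dim (G.lower e)] : Measure (E n)).real (G.mcellSet e m) :=
    simplex_measureReal_pos (G.mvert_indep e m) (by simp)
  have hsum := divPairing_eq_zero ha (0, fun e _ => a (G.upper e) - a (G.lower e))
  rw [divPairing_mortar_const] at hsum
  simp_rw [← Finset.mul_sum, ← mul_assoc] at hsum
  have hterm := (Finset.sum_eq_zero_iff_of_nonneg fun e _ => mul_nonneg (mul_self_nonneg _)
    (Finset.sum_nonneg fun m _ => (hmcell e m).le)).1 hsum e (Finset.mem_univ e)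
  have harea := Finset.sum_pos (fun m _ => hmcell e m) Finset.univ_nonempty
  exact sub_eq_zero.1 (mul_self_eq_zero.1 ((mul_eq_zero.1 hterm).resolve_right harea.ne'))

end Kernel

theorem opBT_injective : Function.Injective G.opBT := by
  refine (injective_iff_map_eq_zero _).2 fun p hp => ?_
  obtain ⟨a, rfl⟩ := exists_pressure_eq_const hp
  have hconst (i j : G.Sub) : a i = a j := by
    induction G.connected i j with
    | rel i j h =>
      obtain ⟨e, rfl, rfl⟩ := h
      exact pressure_upper_eq_lower hp e
    | refl => rfl
    | symm _ _ _ ih => exact ih.symm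
    | trans _ _ _ _ _ ih₁ ih₂ => exact ih₁.trans ih₂
  obtain ⟨i, F, hF⟩ := G.exists_dirichlet
  funext j T
  exact (hconst j i).trans (pressure_eq_zero_of_dirichlet hp hF)

end Mesh

namespace Params

variable {n : ℕ} {G : Mesh n} (P : Params G) {i : G.Sub}

lemma mass_eq (T : G.Cell i) (k l : Fin (G.dim i + 1)) :
    P.mass i T k l = G.rtCoef i T k * G.rtCoef i T l *
      vertexMass (G.dim i) (G.vert i T) (matrixForm (P.K i)⁻¹) k l := by
  rw [mass, vertexMass, ← integral_const_mul]
  simp only [Mesh.rtBasis, Mesh.cellSet, matrixForm_apply, map_smul, real_inner_smul_left,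
    real_inner_smul_right, mul_assoc, mul_left_comm (G.rtCoef i T l)]

lemma sum_mass_eq (T : G.Cell i) (u : Fin (G.dim i + 1) → ℝ) :
    ∑ k, ∑ l, u k * u l * P.mass i T k l =
      ∑ k, ∑ l, (u k * G.rtCoef i T k) * (u l * G.rtCoef i T l) *
        vertexMass (G.dim i) (G.vert i T) (matrixForm (P.K i)⁻¹) k l := by
  simp only [mass_eq]
  exact Finset.sum_congr rfl fun k _ => Finset.sum_congr rfl fun l _ => by ring

lemma mass_eq_zero (hi : G.dim i = 0) (T : G.Cell i) (k l : Fin (G.dim i + 1)) :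
    P.mass i T k l = 0 := by
  rw [mass_eq, G.rtCoef_eq_zero hi, zero_mul, zero_mul]

lemma mass_comm (T : G.Cell i) (k l : Fin (G.dim i + 1)) : P.mass i T k l = P.mass i T l k := by
  have hsymm := (symmPosDef_matrixForm (P.K_posDef i).inv).symm
  simp only [mass_eq, vertexMass, hsymm (_ - G.vert i T k), mul_comm (G.rtCoef i T k)]

lemma sum_mass_pos (hi : G.dim i ≠ 0) (T : G.Cell i) {u : Fin (G.dim i + 1) → ℝ} (hu : u ≠ 0) :
    0 < ∑ k, ∑ l, u k * u l * P.mass i T k l := by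
  have : Nontrivial (Fin (G.dim i + 1)) := Fin.nontrivial_iff_two_le.2 (by lia)
  rw [sum_mass_eq]
  refine sum_vertexMass_pos (G.vert_indep i T) (Fintype.card_fin _)
    (symmPosDef_matrixForm (P.K_posDef i).inv) (a := fun k => u k * G.rtCoef i T k) fun h => hu ?_
  funext k
  exact (mul_eq_zero.1 (congrFun h k)).resolve_right (G.rtCoef_pos hi T k).ne'

lemma sum_mass_nonneg (T : G.Cell i) (u : Fin (G.dim i + 1) → ℝ) :
    0 ≤ ∑ k, ∑ l, u k * u l * P.mass i T k l := by
  rcases eq_or_ne (G.dim i) 0 with hi | hi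
  · simp [P.mass_eq_zero hi]
  rcases eq_or_ne u 0 with rfl | hu
  · simp
  · exact (P.sum_mass_pos hi T hu).le

lemma sum_mass_le (T : G.Cell i) (u : Fin (G.dim i + 1) → ℝ) :
    ∑ k, ∑ l, u k * u l * P.mass i T k l ≤ (G.dim i + 1) * ∑ k, u k * u k * P.mass i T k k := by
  simpa using sum_sum_mul_le_card_mul_sum_diag (P.sum_mass_nonneg T) u

lemma mul_mass_self_le {σ κ : ℝ} (hσ : G.ShapeRegular σ) (hκ : P.AnisotropyLE κ) (hκ0 : 0 ≤ κ)
    (T : G.Cell i) (u : Fin (G.dim i + 1) → ℝ) (k : Fin (G.dim i + 1)) :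
    u k * u k * P.mass i T k k ≤
      κ * σ ^ 2 * (8 * 2 ^ G.dim i + 2) * ∑ k, ∑ l, u k * u l * P.mass i T k l := by
  rcases eq_or_ne (G.dim i) 0 with hi | hi
  · simp [P.mass_eq_zero hi]
  have : Nontrivial (Fin (G.dim i + 1)) := Fin.nontrivial_iff_two_le.2 (by lia)
  obtain ⟨c, hc, r, hr, hball, hdiam⟩ := hσ i T
  have haniso := matrixForm_inv_anisotropy (P.K_posDef i) (κ := κ) fun ξ η => by
    simpa only [matrixForm_apply, real_inner_comm] using hκ i ξ η
  have hle := mul_vertexMass_self_le (G.vert_indep i T) (Fintype.card_fin _) hκ0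
    (symmPosDef_matrixForm (P.K_posDef i).inv).nonneg haniso hc hr hball hdiam
    (fun k => u k * G.rtCoef i T k) k
  rw [sum_mass_eq, mass_eq]
  exact (le_of_eq (by ring)).trans hle

lemma fluxForm_apply (u v : G.Flux) :
    P.fluxForm u v = ∑ i, ∑ T, ∑ k, ∑ l, u i T k * v i T l * P.mass i T k l :=
  rfl

lemma fluxFormD_apply (u v : G.Flux) :
    P.fluxFormD u v = ∑ i, ∑ T, ∑ k, u i T k * v i T k * P.mass i T k k :=
  rfl

lemma mortarForm_apply (lam μ : G.Lam) :
    P.mortarForm lam μ = ∑ e, ∑ m, lam e m * μ e m *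
      ∫ x in G.mcellSet e m, P.γ e * (P.Kν e x)⁻¹ ∂μHE[G.dim (G.lower e)] :=
  rfl

lemma opA_apply (w r : G.Wh) :
    P.opA w r = P.fluxForm (G.total w) (G.total r) + P.mortarForm w.2 r.2 :=
  rfl

lemma opDA_apply (w r : G.Wh) :
    P.opDA w r = P.fluxFormD (G.total w) (G.total r) + P.mortarForm w.2 r.2 :=
  rfl

lemma fluxForm_comm (u v : G.Flux) : P.fluxForm u v = P.fluxForm v u := by
  simp_rw [fluxForm_apply]
  refine Finset.sum_congr rfl fun i _ => Finset.sum_congr rfl fun T _ => ?_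
  rw [Finset.sum_comm]
  refine Finset.sum_congr rfl fun k _ => Finset.sum_congr rfl fun l _ => ?_
  rw [P.mass_comm, mul_comm (u i T l)]

lemma fluxFormD_comm (u v : G.Flux) : P.fluxFormD u v = P.fluxFormD v u := by
  simp_rw [fluxFormD_apply, mul_comm (u _ _ _)]

lemma mortarForm_comm (lam μ : G.Lam) : P.mortarForm lam μ = P.mortarForm μ lam := by
  simp_rw [mortarForm_apply, mul_comm (lam _ _)]

lemma fluxForm_nonneg (u : G.Flux) : 0 ≤ P.fluxForm u u :=
  Finset.sum_nonneg fun i _ => Finset.sum_nonneg fun T _ => P.sum_mass_nonneg T (u i T)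

lemma fluxForm_pos {u : G.Flux} (hu : u ∈ G.Vh) (h0 : u ≠ 0) : 0 < P.fluxForm u u := by
  obtain ⟨i, T, hT⟩ : ∃ i T, u i T ≠ 0 := by
    by_contra! h
    exact h0 (funext fun i => funext fun T => h i T)
  have hi : G.dim i ≠ 0 := fun hi => hT (funext fun k => hu.2 i (T, k) (G.kind_point i _ hi))
  exact Finset.sum_pos'
    (fun i _ => Finset.sum_nonneg fun T _ => P.sum_mass_nonneg T (u i T))
    ⟨i, Finset.mem_univ i, Finset.sum_pos' (fun T _ => P.sum_mass_nonneg T (u i T))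
      ⟨T, Finset.mem_univ T, P.sum_mass_pos hi T hT⟩⟩

lemma fluxForm_le (u : G.Flux) : P.fluxForm u u ≤ (n + 1) * P.fluxFormD u u := by
  simp_rw [fluxForm_apply, fluxFormD_apply, Finset.mul_sum (s := Finset.univ (α := G.Sub)),
    Finset.mul_sum (s := Finset.univ (α := G.Cell _))]
  refine Finset.sum_le_sum fun i _ => Finset.sum_le_sum fun T _ =>
    (P.sum_mass_le T (u i T)).trans ?_
  have hdiag : 0 ≤ ∑ k, u i T k * u i T k * P.mass i T k k :=
    nonneg_of_mul_nonneg_right ((P.sum_mass_nonneg T (u i T)).trans (P.sum_mass_le T (u i T)))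
      (by positivity)
  have hdim := G.dim_le i
  gcongr

lemma fluxFormD_le {σ κ : ℝ} (hσ : G.ShapeRegular σ) (hκ : P.AnisotropyLE κ) (hκ0 : 0 ≤ κ)
    (u : G.Flux) :
    P.fluxFormD u u ≤ (n + 1) * (κ * σ ^ 2 * (8 * 2 ^ n + 2)) * P.fluxForm u u := by
  simp_rw [fluxForm_apply, fluxFormD_apply, Finset.mul_sum (s := Finset.univ (α := G.Sub)),
    Finset.mul_sum (s := Finset.univ (α := G.Cell _))]
  refine Finset.sum_le_sum fun i _ => Finset.sum_le_sum fun T _ => ?_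
  have hsum := Finset.sum_le_card_nsmul Finset.univ _ _ fun k _ =>
    P.mul_mass_self_le hσ hκ hκ0 T (u i T) k
  rw [Finset.card_univ, Fintype.card_fin, nsmul_eq_mul, Nat.cast_add_one, ← mul_assoc] at hsum
  have hnonneg := P.sum_mass_nonneg T (u i T)
  have hdim := G.dim_le i
  refine hsum.trans ?_
  gcongr
  norm_num

lemma integral_mortar_weight_pos (e : G.Ifc) (m : G.MCell e) :
    0 < ∫ x in G.mcellSet e m, P.γ e * (P.Kν e x)⁻¹ ∂μHE[G.dim (G.lower e)] := by
  obtain ⟨a, b, ha, hab⟩ := P.Kν_bounds e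
  have hpos (x : E n) : 0 < P.Kν e x := ha.trans_le (hab x).1
  have hint : IntegrableOn (fun x => P.γ e * (P.Kν e x)⁻¹) (G.mcellSet e m)
      μHE[G.dim (G.lower e)] := by
    refine Measure.integrableOn_of_bounded (M := P.γ e * a⁻¹)
      (simplex_measure_ne (G.mvert_indep e m) (Fintype.card_fin _)).2
      ((P.Kν_measurable e).inv.const_mul _).aestronglyMeasurable
      (Filter.Eventually.of_forall fun x => ?_)
    rw [Real.norm_of_nonneg (mul_pos (P.γ_pos e) (inv_pos.2 (hpos x))).le]
    exact mul_le_mul_of_nonneg_left (inv_anti₀ ha (hab x).1) (P.γ_pos e).le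
  refine (setIntegral_pos_iff_support_of_nonneg_ae (Filter.Eventually.of_forall fun x =>
    (mul_pos (P.γ_pos e) (inv_pos.2 (hpos x))).le) hint).2 ?_
  have hsupport : Function.support (fun x => P.γ e * (P.Kν e x)⁻¹) = Set.univ :=
    Set.eq_univ_of_forall fun x => (mul_pos (P.γ_pos e) (inv_pos.2 (hpos x))).ne'
  rw [hsupport, Set.univ_inter]
  exact (simplex_measure_ne (G.mvert_indep e m) (Fintype.card_fin _)).1.bot_lt

lemma mortarForm_pos {μ : G.Lam} (h0 : μ ≠ 0) : 0 < P.mortarForm μ μ := by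
  obtain ⟨e, m, hm⟩ : ∃ e m, μ e m ≠ 0 := by
    by_contra! h
    exact h0 (funext fun e => funext fun m => h e m)
  have hnonneg (e : G.Ifc) (m : G.MCell e) : 0 ≤ μ e m * μ e m *
      ∫ x in G.mcellSet e m, P.γ e * (P.Kν e x)⁻¹ ∂μHE[G.dim (G.lower e)] :=
    mul_nonneg (mul_self_nonneg _) (P.integral_mortar_weight_pos e m).le
  exact Finset.sum_pos' (fun e _ => Finset.sum_nonneg fun m _ => hnonneg e m)
    ⟨e, Finset.mem_univ e, Finset.sum_pos' (fun m _ => hnonneg e m)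
      ⟨m, Finset.mem_univ m, mul_pos (mul_self_pos.2 hm) (P.integral_mortar_weight_pos e m)⟩⟩

lemma mortarForm_nonneg (μ : G.Lam) : 0 ≤ P.mortarForm μ μ := by
  rcases eq_or_ne μ 0 with rfl | hμ
  · rw [map_zero]
  · exact (P.mortarForm_pos hμ).le

lemma opA_pos {r : G.Wh} (hr : r ≠ 0) : 0 < P.opA r r := by
  obtain ⟨u, μ⟩ := r
  rcases eq_or_ne μ 0 with rfl | hμ
  · have hu : (u : G.Flux) ≠ 0 := by simpa using hr
    refine add_pos_of_pos_of_nonneg (P.fluxForm_pos (G.total_mem_Vh _) ?_) (P.mortarForm_nonneg _)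
    rwa [G.total_mk_zero]
  · exact add_pos_of_nonneg_of_pos (P.fluxForm_nonneg _) (P.mortarForm_pos hμ)

lemma opA_le (r : G.Wh) : P.opA r r ≤ (n + 1) * P.opDA r r := by
  rw [opA_apply, opDA_apply, mul_add]
  exact add_le_add (P.fluxForm_le _)
    (le_mul_of_one_le_left (P.mortarForm_nonneg _) (le_add_of_nonneg_left n.cast_nonneg))

lemma opDA_le {σ κ : ℝ} (hσ : G.ShapeRegular σ) (hκ : P.AnisotropyLE κ) (hκ0 : 0 ≤ κ)
    (r : G.Wh) :
    P.opDA r r ≤ (1 + (n + 1) * (κ * σ ^ 2 * (8 * 2 ^ n + 2))) * P.opA r r := by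
  rw [opA_apply, opDA_apply, mul_add]
  refine add_le_add ((P.fluxFormD_le hσ hκ hκ0 _).trans ?_)
    (le_mul_of_one_le_left (P.mortarForm_nonneg _) (le_add_of_nonneg_right (by positivity)))
  exact mul_le_mul_of_nonneg_right (le_add_of_nonneg_left zero_le_one) (P.fluxForm_nonneg _)

theorem symmPosDef_opA : SymmPosDef P.opA where
  symm w r := by rw [opA_apply, opA_apply, fluxForm_comm, mortarForm_comm]
  pos _ := P.opA_pos

theorem symmPosDef_opDA : SymmPosDef P.opDA where
  symm w r := by rw [opDA_apply, opDA_apply, fluxFormD_comm, mortarForm_comm]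
  pos r hr := pos_of_mul_pos_right ((P.opA_pos hr).trans_le (P.opA_le r)) (by positivity)

variable {P} in
lemma AnisotropyLE.mono {κ κ' : ℝ} (h : P.AnisotropyLE κ) (hκ : κ ≤ κ') : P.AnisotropyLE κ' :=
  fun i ξ η => (h i ξ η).trans (mul_le_mul_of_nonneg_right hκ (mul_nonneg
    ((real_inner_comm _ _).trans_ge
      ((symmPosDef_matrixForm (P.K_posDef i)).nonneg η)) (sq_nonneg _)))

theorem spectrallyEquivalent {σ κ : ℝ} (hσ : G.ShapeRegular σ) (hκ : P.AnisotropyLE κ)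
    (hκ0 : 0 ≤ κ) :
    P.SpectrallyEquivalent (1 + (n + 1) * (κ * σ ^ 2 * (8 * 2 ^ n + 2)))⁻¹ (n + 1) :=
  fun r => ⟨(inv_mul_le_iff₀ (by positivity)).2 (P.opDA_le hσ hκ hκ0 r), P.opA_le r⟩

theorem symmPosDef_schur : SymmPosDef P.schur :=
  P.symmPosDef_opDA.schurComplement G.opBT_injective

theorem wellDefined : P.WellDefined := by
  have hA := P.symmPosDef_opA
  have hS := P.symmPosDef_schur
  refine ⟨P.symmPosDef_opDA.bijective, hA.bijective.prodMap hS.bijective, ?_,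
    fun x y => congrArg₂ (· + ·) (hA.symm _ _) (hS.symm _ _), ?_⟩
  · have h : ⇑P.blockL = (LinearEquiv.ofBijective P.opA hA.bijective).skewProd
        (LinearEquiv.ofBijective P.schur hS.bijective) (-G.opB) :=
      funext fun x => Prod.ext rfl (add_comm _ _)
    exact h ▸ LinearEquiv.bijective _
  · rintro ⟨w, p⟩ hx
    change 0 < P.opA w w + P.schur p p
    rcases eq_or_ne w 0 with rfl | hw
    · have hp : p ≠ 0 := by rintro rfl; exact hx rfl
      simpa using hS.pos p hp
    · exact add_pos_of_pos_of_nonneg (hA.pos w hw) (hS.nonneg p)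

variable {P}

lemma SpectrallyEquivalent.schur {c₁ c₂ : ℝ} (h : P.SpectrallyEquivalent c₁ c₂) (hc₁ : 0 < c₁)
    (p : G.Qh) :
    schurComplement P.opA G.opB p p ≤ c₁⁻¹ * P.schur p p ∧
      P.schur p p ≤ c₂ * schurComplement P.opA G.opB p p := by
  have hA := P.symmPosDef_opA
  have hD := P.symmPosDef_opDA
  have hAp := apply_invOp hA.bijective (G.opBT p)
  have hDp := apply_invOp hD.bijective (G.opBT p)
  constructor
  · rw [le_inv_mul_iff₀ hc₁]
    exact (hA.mul_apply_inv_le hD hc₁.le (fun r => (h r).1.trans_eq (one_mul _).symm) hAp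
      hDp).trans_eq (one_mul _)
  · exact (one_mul _).symm.trans_le (hD.mul_apply_inv_le hA zero_le_one
      (fun r => (one_mul _).trans_le (h r).2) hDp hAp)

variable (P) in
lemma exists_precondL_opCalA_eq (w : G.Wh) (p : G.Qh) :
    ∃ a q, P.precondL (P.opCalA (w, p)) = (w + a, q) ∧
      P.opA a a = schurComplement P.opA G.opB p p ∧
      P.schur q = schurComplement P.opA G.opB p := by
  have hA := P.symmPosDef_opA
  obtain ⟨-, -, hL, -⟩ := P.wellDefined
  set a := invOp P.opA (G.opBT p)
  obtain ⟨⟨z, q⟩, hy⟩ : ∃ y, P.precondL (P.opCalA (w, p)) = y := ⟨_, rfl⟩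
  have hAa : P.opA a = G.opBT p := apply_invOp hA.bijective _
  have hblock : P.blockL (z, q) = P.opCalA (w, p) := hy ▸ apply_invOp hL _
  obtain ⟨hrow₁, hrow₂⟩ := Prod.ext_iff.1 hblock
  change P.opA z = P.opA w + G.opBT p at hrow₁
  change -(G.opB z) + P.schur q = -(G.opB w) at hrow₂
  have hz : z = w + a := hA.bijective.1 (by rw [hrow₁, map_add, hAa])
  refine ⟨a, q, by rw [hy, hz], by rw [hAa]; rfl, ?_⟩
  calc P.schur q = G.opB z - G.opB w := by rw [← sub_eq_zero, ← sub_eq_zero.2 hrow₂]; abel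
    _ = G.opB a := by rw [hz, map_add, add_sub_cancel_left]

theorem SpectrallyEquivalent.fovBounds {c₁ c₂ : ℝ} (h : P.SpectrallyEquivalent c₁ c₂)
    (hc₁ : 0 < c₁) (hc₂ : 0 < c₂) :
    P.FOVBounds (1 / 2 * min 1 c₂⁻¹) (max 2 (2 * c₁⁻¹)) := by
  have hA := P.symmPosDef_opA
  have hS := P.symmPosDef_schur
  have hT : SymmPosDef (schurComplement P.opA G.opB) := hA.schurComplement G.opBT_injective
  obtain ⟨-, -, -, -, hpos⟩ := P.wellDefined
  rintro ⟨w, p⟩ hx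
  obtain ⟨a, q, hy, ha, hq⟩ := P.exists_precondL_opCalA_eq w p
  rw [hy]
  constructor
  · rw [le_div_iff₀ (hpos _ hx)]
    exact fieldOfValues_lower hA hS hc₂ (h.schur hc₁ p).2 ha hq
  · rw [normBD, normBD, div_le_iff₀ (Real.sqrt_pos.2 (hpos _ hx))]
    refine Real.sqrt_le_iff.2 ⟨by positivity, ?_⟩
    rw [mul_pow, Real.sq_sqrt (hpos _ hx).le]
    exact fieldOfValues_upper hA hS hT (inv_pos.2 hc₁).le (fun p => (h.schur hc₁ p).1) ha hq

end Params

end MixedDim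

theorem mainTheorem6 (n : ℕ) :
    (∀ σ κ : ℝ, ∃ c₁ c₂ : ℝ, 0 < c₁ ∧ 0 < c₂ ∧
      ∀ (G : MixedDim.Mesh n) (P : MixedDim.Params G), G.ShapeRegular σ → P.AnisotropyLE κ →
        P.SpectrallyEquivalent c₁ c₂ ∧
        P.FOVBounds (1 / 2 * min 1 c₂⁻¹) (max 2 (2 * c₁⁻¹))) ∧
    (∀ (G : MixedDim.Mesh n) (P : MixedDim.Params G), P.WellDefined ∧
      ∀ c₁ c₂ : ℝ, 0 < c₁ → 0 < c₂ → P.SpectrallyEquivalent c₁ c₂ →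
        P.FOVBounds (1 / 2 * min 1 c₂⁻¹) (max 2 (2 * c₁⁻¹))) := by
  refine ⟨fun σ κ => ?_, fun G P => ⟨P.wellDefined, fun _ _ hc₁ hc₂ h => h.fovBounds hc₁ hc₂⟩⟩
  have hc₁ : 0 < (1 + (n + 1) * (max κ 0 * σ ^ 2 * (8 * 2 ^ n + 2)))⁻¹ := by positivity
  have hc₂ : (0 : ℝ) < n + 1 := by positivity
  refine ⟨_, _, hc₁, hc₂, fun G P hσ hκ => ?_⟩
  have h := P.spectrallyEquivalent hσ (hκ.mono (le_max_left κ 0)) (le_max_right κ 0)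
  exact ⟨h, h.fovBounds hc₁ hc₂⟩
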